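/- Let $\rho>0$, $\eta>0$ and $h\ge 0$, and write $\mathbb{R}^+=[0,+\infty)$. Consider the Cauchy problem $$\frac1\eta\,\partial_t f(t,x)=\frac{\rho}{3}\bigl[f(t,x+h)+f(t,x-h)-2f(t,x)\bigr],\qquad f(0,\cdot)=f^{\mathrm{in}},\qquad (t,x)\in\mathbb{R}^+\times\mathbb{R}.\tag{1}$$ For $f^{\mathrm{in}}\in\mathcal S'(\mathbb{R})$, a solution of (1) in the sense of tempered distributions is an $f\in\mathcal S'(\mathbb{R}\times\mathbb{R})$ with $\operatorname{supp} f\subset\mathbb{R}^+\times\mathbb{R}$ such that, for all $\varphi\in\mathcal S(\mathbb{R}\times\mathbb{R})$, $$\frac{3}{\rho\eta}\langle\langle f,\varphi_t\rangle\rangle+\frac{3}{\rho\eta}\langle f^{\mathrm{in}},\varphi(0,\cdot)\rangle+\langle\langle f,\varphi(t,x+h)+\varphi(t,x-h)-2\varphi(t,x)\rangle\rangle=0 .$$ 1. For every $f^{\mathrm{in}}\in\mathcal S'(\mathbb{R})$ there exists a unique solution of (1) in the sense of tempered distributions. 2. If $f^{\mathrm{in}}\in L^2(\mathbb{R})$ (complex-valued),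 then the unique solution is a function of $(t,x)\in\mathbb{R}^+\times\mathbb{R}$ (extended by zero to $t<0$), it belongs to $C^\infty([0,T];L^2(\mathbb{R}))$ for every $T>0$, and $f(0,\cdot)=f^{\mathrm{in}}$. Moreover, for every $t\ge 0$ and a.e. $x\in\mathbb{R}$, $$f(t,x)=\int_{\mathbb{R}} f^{\mathrm{in}}(x-y)\,F_t(\mathrm{d}y),\qquad F_t=e^{-2\rho\eta t/3}\sum_{k=0}^{\infty}\frac{(\eta\rho t)^k}{3^k\,k!}\sum_{i=0}^{k}\binom{k}{i}\,\delta_{-(k-2i)h},$$ the integral being absolutely convergent. 3. If $f^{\mathrm{in}}\in L^2(\mathbb{R})$ and $f^{\mathrm{in}}\ge 0$ a.e. on $\mathbb{R}$, then $f(t,x)\ge 0$ for a.e. $(t,x)\in\mathbb{R}^+\times\mathbb{R}$. 4. If $p\in[1,+\infty]$ and $f^{\mathrm{in}}\in L^p(\mathbb{R})\cap L^2(\mathbb{R})$, then $f\in C^\infty([0,T];L^p(\mathbb{R})\cap L^2(\mathbb{R}))$ for every $T>0$. If $p=1$, mass is conserved: for every $t\ge0$, $f(t,\cdot)\in L^1(\mathbb{R})$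 and $\int_{\mathbb{R}}f(t,x)\,\mathrm{d}x=\int_{\mathbb{R}}f^{\mathrm{in}}(x)\,\mathrm{d}x$. -/

import Mathlib

open MeasureTheory SchwartzMap LineDeriv
open scoped ContDiff ComplexOrder

noncomputable section

/-- The time slice `x ↦ φ (t, x)` of a Schwartz function of `(t, x)`. -/
def timeSlice (t : ℝ) (φ : 𝓢(ℝ × ℝ, ℂ)) : 𝓢(ℝ, ℂ) :=
  SchwartzMap.compCLMOfAntilipschitz (K := 1) ℂ (g := fun x : ℝ => (t, x))
    (by
      have e : (fun x : ℝ => (t, x)) =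
          fun x : ℝ => ((t, 0) : ℝ × ℝ) + ContinuousLinearMap.inr ℝ ℝ ℝ x := by
        funext x
        simp
      rw [e]
      fun_prop)
    (fun x y => by simp [Prod.edist_eq]) φ

theorem timeSlice_apply (t : ℝ) (φ : 𝓢(ℝ × ℝ, ℂ)) (x : ℝ) : timeSlice t φ x = φ (t, x) := rfl

/-- The time derivative `φ_t` of a Schwartz function of `(t, x)`. -/
def timeDeriv (φ : 𝓢(ℝ × ℝ, ℂ)) : 𝓢(ℝ × ℝ, ℂ) := ∂_{((1, 0) : ℝ × ℝ)} φ

/-- The second difference `φ(t, x + h) + φ(t, x - h) - 2 φ(t, x)` in the second variable. -/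
def secondDiff (h : ℝ) (φ : 𝓢(ℝ × ℝ, ℂ)) : 𝓢(ℝ × ℝ, ℂ) :=
  SchwartzMap.compSubConstCLM ℂ ((0, -h) : ℝ × ℝ) φ
    + SchwartzMap.compSubConstCLM ℂ ((0, h) : ℝ × ℝ) φ - (2 : ℂ) • φ

theorem secondDiff_apply (h : ℝ) (φ : 𝓢(ℝ × ℝ, ℂ)) (t x : ℝ) :
    secondDiff h φ (t, x) = φ (t, x + h) + φ (t, x - h) - 2 * φ (t, x) := by
  simp [secondDiff]

/-- The closed half plane `ℝ⁺ × ℝ`. -/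
def halfPlane : Set (ℝ × ℝ) := Set.Ici 0 ×ˢ Set.univ

/-- `f` is a solution, in the sense of tempered distributions, of
`(1 / η) ∂ₜ f = (ρ / 3) [f(t, x + h) + f(t, x - h) - 2 f(t, x)]`, `f(0, ·) = fIn`. -/
def IsTemperedSolution (ρ η h : ℝ) (fIn : 𝓢'(ℝ, ℂ)) (f : 𝓢'(ℝ × ℝ, ℂ)) : Prop :=
  Distribution.dsupport f ⊆ halfPlane ∧
    ∀ φ : 𝓢(ℝ × ℝ, ℂ),
      ((3 / (ρ * η) : ℝ) : ℂ) * f (timeDeriv φ)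
        + ((3 / (ρ * η) : ℝ) : ℂ) * fIn (timeSlice 0 φ)
        + f (secondDiff h φ) = 0

/-- The tempered distribution `f` is (integration against) the function `F` on `ℝ⁺ × ℝ`,
and zero elsewhere. -/
def IsGivenBy (f : 𝓢'(ℝ × ℝ, ℂ)) (F : ℝ × ℝ → ℂ) : Prop :=
  AEStronglyMeasurable F (volume.restrict halfPlane) ∧
    ∀ φ : 𝓢(ℝ × ℝ, ℂ),
      IntegrableOn (fun z => φ z * F z) halfPlane ∧ f φ = ∫ z in halfPlane, φ z * F z

/-- The space `L^p(ℝ) ∩ L²(ℝ)`: pairs of an `L^p` class and an `L²` class that agree almost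
everywhere, with the norm `max (‖·‖_p) (‖·‖_2)` inherited from the product. -/
def LpInterL2 (p : ENNReal) [Fact (1 ≤ p)] :
    Submodule ℝ (Lp ℂ p (volume : Measure ℝ) × Lp ℂ 2 (volume : Measure ℝ)) where
  carrier := {w | (w.1 : ℝ → ℂ) =ᵐ[volume] (w.2 : ℝ → ℂ)}
  zero_mem' := (Lp.coeFn_zero ℂ p volume).trans (Lp.coeFn_zero ℂ 2 volume).symm
  add_mem' := fun {a b} (ha : (a.1 : ℝ → ℂ) =ᵐ[volume] (a.2 : ℝ → ℂ))
      (hb : (b.1 : ℝ → ℂ) =ᵐ[volume] (b.2 : ℝ → ℂ)) =>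
    (Lp.coeFn_add a.1 b.1).trans ((ha.add hb).trans (Lp.coeFn_add a.2 b.2).symm)
  smul_mem' := fun c a (ha : (a.1 : ℝ → ℂ) =ᵐ[volume] (a.2 : ℝ → ℂ)) =>
    (Lp.coeFn_smul c a.1).trans ((ha.const_smul c).trans (Lp.coeFn_smul c a.2).symm)

/-- The convolution kernel at time `t`, a sum of Dirac masses:
`e^{-2ρηt/3} ∑ₖ (ηρt)^k / (3^k k!) ∑_{i ≤ k} (k choose i) δ₀(x + (k - 2 i) h)`. -/
def gameKernel (ρ η h t : ℝ) : Measure ℝ :=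
  Measure.sum fun k : ℕ => ∑ i ∈ Finset.range (k + 1),
    ENNReal.ofReal (Real.exp (-(2 * ρ * η * t / 3))
        * ((η * ρ * t) ^ k / (3 ^ k * (k.factorial : ℝ))) * (k.choose i : ℝ))
      • Measure.dirac (-(((k : ℝ) - 2 * (i : ℝ)) * h))

end

/-!
Put `lam = 2ρη/3` and let `A` be the average of the translations by `h` and `-h`. The equation reads
`∂ₜ f = lam (A - 1) f`, so its solution operator is
`exp (lam t (A - 1)) = ∑ₖ e^{-lam t} (lam t)^k / k! Aᵏ`: a Poisson number of steps of a simple random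
walk. Expanding `Aᵏ` binomially gives the convolution kernel.

For tempered data this operator is applied to test functions, and only after pairing with a
functional `Λ`, so that no convergence in Schwartz space is needed. The scalar function
`poissonPairing` stands for `s ↦ Λ (exp (s L) φ)`, where `L = ∂ₜ + lam (A - 1)` is the
transposed operator up to sign. Since `Aᵏ` and translations cost only polynomial factors in the
Schwartz seminorms and Poisson moments grow polynomially, its series converges and may be
differentiated (`hasDerivAt_poissonPairing`); weak differentiability of translations on Schwartz space
is a second-order Taylor estimate (`hasDerivAt_schwartzTranslate`).

* Existence: pairing the datum with the slice at time `s` of `φ`, evolved for a time `s`, and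
  integrating over `s > 0` gives a tempered distribution (`exists_isTemperedSolution`). The decay in
  time of `φ` is used by moving a weight `(1 + s²)ⁿ` onto `φ`, and the equation is the fundamental
  theorem of calculus.
* Uniqueness: the difference `d` of two solutions annihilates the range of `L`, so `d (exp (s L) φ)`
  does not depend on `s`. If `φ` has compact support, each term of the series is supported in
  negative times for large `s`, and `d` vanishes there (`isTemperedSolution_unique`). A cutoff
  argument passes to all `φ`.

For data in `L^p` the average is a contraction of a Banach space, so the evolution `poissonCurve` is
an operator exponential, hence smooth in time; this applies verbatim to `L^p ∩ L²`, which is closed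
in `L^p × L²`. The series also converges almost everywhere (`hasSum_coeFn_poissonCurve`), which
yields the convolution formula and positivity. The average is symmetric, so the pairing with test
functions is that of the tempered solution (`slicePairing_toTemperedDistribution`), and it preserves
the integral, which gives conservation of mass.
-/

noncomputable section

/-! ### Translations of Schwartz functions -/

theorem norm_pow_mul_le_one_add_norm_pow_mul {E : Type*} [NormedAddCommGroup E]
    (x a : E) {k l : ℕ} (h : k ≤ l) :
    ‖x‖ ^ k ≤ (1 + ‖a‖) ^ l * (1 + ‖x + a‖) ^ k := by
  have h1 : ‖x‖ ≤ (1 + ‖a‖) * (1 + ‖x + a‖) := by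
    have h2 : ‖x‖ ≤ ‖x + a‖ + ‖a‖ := by simpa using norm_sub_le (x + a) a
    nlinarith [norm_nonneg a, norm_nonneg (x + a), mul_nonneg (norm_nonneg a) (norm_nonneg (x + a))]
  calc ‖x‖ ^ k ≤ ((1 + ‖a‖) * (1 + ‖x + a‖)) ^ k := by gcongr
    _ = (1 + ‖a‖) ^ k * (1 + ‖x + a‖) ^ k := mul_pow _ _ _
    _ ≤ _ := by
      gcongr
      linarith [norm_nonneg a]

section Translation

variable {E : Type*} [NormedAddCommGroup E] [NormedSpace ℝ E]

/-- The translation `φ ↦ φ(· + a)` of Schwartz functions. -/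
def schwartzTranslate (a : E) : 𝓢(E, ℂ) →L[ℂ] 𝓢(E, ℂ) := SchwartzMap.compSubConstCLM ℂ (-a)

@[simp]
theorem schwartzTranslate_apply (a : E) (φ : 𝓢(E, ℂ)) (x : E) :
    schwartzTranslate a φ x = φ (x + a) := by
  simp [schwartzTranslate]

theorem schwartzTranslate_translate (a b : E) (φ : 𝓢(E, ℂ)) :
    schwartzTranslate a (schwartzTranslate b φ) = schwartzTranslate (a + b) φ := by
  ext x
  simp [add_assoc]

@[simp]
theorem schwartzTranslate_zero (φ : 𝓢(E, ℂ)) : schwartzTranslate (0 : E) φ = φ := by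
  ext x
  simp

/-- The average `φ ↦ (φ(· + v) + φ(· - v)) / 2` of two opposite translates. -/
def schwartzAverage (v : E) : 𝓢(E, ℂ) →L[ℂ] 𝓢(E, ℂ) :=
  (1 / 2 : ℂ) • (schwartzTranslate v + schwartzTranslate (-v))

theorem schwartzAverage_eq (v : E) (φ : 𝓢(E, ℂ)) :
    schwartzAverage v φ = (1 / 2 : ℂ) • (schwartzTranslate v φ + schwartzTranslate (-v) φ) := rfl

theorem schwartzAverage_apply (v : E) (φ : 𝓢(E, ℂ)) (x : E) :
    schwartzAverage v φ x = (φ (x + v) + φ (x - v)) / 2 := by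
  simp [schwartzAverage_eq, sub_eq_add_neg]
  ring

theorem schwartzAverage_translate (v a : E) (φ : 𝓢(E, ℂ)) :
    schwartzAverage v (schwartzTranslate a φ) = schwartzTranslate a (schwartzAverage v φ) := by
  ext x
  simp only [schwartzAverage_apply, schwartzTranslate_apply]
  congr 3 <;> abel

/-- The supremum of the Schwartz seminorms with weight at most `m.1` and order at most `m.2`. -/
def schwartzSup (m : ℕ × ℕ) : Seminorm ℂ 𝓢(E, ℂ) :=
  (Finset.Iic m).sup (schwartzSeminormFamily ℂ E ℂ)

theorem one_add_norm_pow_mul_le_schwartzSup {m : ℕ × ℕ} {k n : ℕ} (hk : k ≤ m.1) (hn : n ≤ m.2)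
    (φ : 𝓢(E, ℂ)) (x : E) :
    (1 + ‖x‖) ^ k * ‖iteratedFDeriv ℝ n φ x‖ ≤ 2 ^ m.1 * schwartzSup m φ :=
  one_add_le_sup_seminorm_apply (𝕜 := ℂ) hk hn φ x

theorem schwartzSup_le_bound {m : ℕ × ℕ} {φ : 𝓢(E, ℂ)} {C : ℝ} (hC : 0 ≤ C)
    (h : ∀ k n : ℕ, k ≤ m.1 → n ≤ m.2 → ∀ x, ‖x‖ ^ k * ‖iteratedFDeriv ℝ n φ x‖ ≤ C) :
    schwartzSup m φ ≤ C := by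
  refine Seminorm.finset_sup_apply_le hC fun i hi => ?_
  rw [Finset.mem_Iic, Prod.le_def] at hi
  exact SchwartzMap.seminorm_le_bound ℂ _ _ φ hC (h _ _ hi.1 hi.2)

/-- A continuous functional is bounded by one of the increasing seminorms. -/
theorem exists_norm_le_schwartzSup (Λ : 𝓢(E, ℂ) →L[ℂ] ℂ) :
    ∃ (m : ℕ × ℕ) (C : ℝ), 0 ≤ C ∧ ∀ φ, ‖Λ φ‖ ≤ C * schwartzSup m φ := by
  have hc : Continuous ((normSeminorm ℂ ℂ).comp Λ.toLinearMap) :=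
    continuous_norm.comp Λ.continuous
  obtain ⟨s, C, -, h⟩ := Seminorm.bound_of_continuous (schwartz_withSeminorms ℂ E ℂ) _ hc
  refine ⟨s.sup id, C, C.2, fun φ => ?_⟩
  have h1 : s.sup (schwartzSeminormFamily ℂ E ℂ) ≤ schwartzSup (s.sup id) :=
    Finset.sup_mono fun i hi => Finset.mem_Iic.2 (Finset.le_sup (f := id) hi)
  calc ‖Λ φ‖ ≤ C * s.sup (schwartzSeminormFamily ℂ E ℂ) φ := h φ
    _ ≤ C * schwartzSup (s.sup id) φ := by
      gcongr
      exact h1 φ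

theorem schwartzSup_translate_le (m : ℕ × ℕ) (a : E) (φ : 𝓢(E, ℂ)) :
    schwartzSup m (schwartzTranslate a φ) ≤ (1 + ‖a‖) ^ m.1 * (2 ^ m.1 * schwartzSup m φ) := by
  have h0 : 0 ≤ schwartzSup m φ := apply_nonneg _ _
  refine schwartzSup_le_bound (by positivity) fun k n hk hn x => ?_
  have h1 : iteratedFDeriv ℝ n (schwartzTranslate a φ) x = iteratedFDeriv ℝ n φ (x + a) := by
    rw [← iteratedFDeriv_comp_add_right]
    congr 1
    ext y
    simp
  rw [h1]
  calc ‖x‖ ^ k * ‖iteratedFDeriv ℝ n φ (x + a)‖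
      ≤ ((1 + ‖a‖) ^ m.1 * (1 + ‖x + a‖) ^ k) * ‖iteratedFDeriv ℝ n φ (x + a)‖ := by
        gcongr
        exact norm_pow_mul_le_one_add_norm_pow_mul x a hk
    _ = (1 + ‖a‖) ^ m.1 * ((1 + ‖x + a‖) ^ k * ‖iteratedFDeriv ℝ n φ (x + a)‖) := by ring
    _ ≤ _ := mul_le_mul_of_nonneg_left (one_add_norm_pow_mul_le_schwartzSup hk hn φ _)
      (by positivity)

/-- Powers of the average move mass by at most `k ‖v‖`, so they cost only a polynomial factor. -/
theorem schwartzSup_average_pow_translate_le (m : ℕ × ℕ) (v a : E) (k : ℕ) (φ : 𝓢(E, ℂ)) :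
    schwartzSup m ((schwartzAverage v ^ k) (schwartzTranslate a φ)) ≤
      (1 + ‖a‖ + k * ‖v‖) ^ m.1 * (2 ^ m.1 * schwartzSup m φ) := by
  have h0 : 0 ≤ schwartzSup m φ := apply_nonneg _ _
  induction k generalizing a with
  | zero => simpa using schwartzSup_translate_le m a φ
  | succ k ih =>
    have key : ∀ w : E, ‖w‖ = ‖v‖ →
        schwartzSup m ((schwartzAverage v ^ k) (schwartzTranslate (w + a) φ)) ≤
          (1 + ‖a‖ + (k + 1 : ℕ) * ‖v‖) ^ m.1 * (2 ^ m.1 * schwartzSup m φ) := fun w hw => by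
      refine (ih (w + a)).trans ?_
      gcongr ?_ ^ m.1 * _
      push_cast
      linarith [norm_add_le w a]
    have e : (schwartzAverage v ^ (k + 1)) (schwartzTranslate a φ) =
        (1 / 2 : ℂ) • ((schwartzAverage v ^ k) (schwartzTranslate (v + a) φ) +
          (schwartzAverage v ^ k) (schwartzTranslate (-v + a) φ)) := by
      rw [pow_succ, mul_apply_eq_comp, schwartzAverage_eq, map_smul, map_add,
        schwartzTranslate_translate, schwartzTranslate_translate]
    rw [e, map_smul_eq_mul]
    have h1 := map_add_le_add (schwartzSup m) ((schwartzAverage v ^ k) (schwartzTranslate (v + a) φ))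
      ((schwartzAverage v ^ k) (schwartzTranslate (-v + a) φ))
    have h2 := key v rfl
    have h3 := key (-v) (norm_neg v)
    have h4 : ‖(1 / 2 : ℂ)‖ = 1 / 2 := by norm_num
    rw [h4]
    linarith

/-! ### Differentiability of translations -/

theorem hasDerivAt_apply_add_smul (φ : 𝓢(E, ℂ)) (x v : E) (r : ℝ) :
    HasDerivAt (fun r : ℝ => φ (x + r • v)) ((∂_{v} φ) (x + r • v)) r := by
  have h1 : HasDerivAt (fun r : ℝ => x + r • v) v r := by
    simpa using ((hasDerivAt_id r).smul_const v).const_add x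
  rw [SchwartzMap.lineDerivOp_apply_eq_fderiv]
  exact (φ.hasFDerivAt (x + r • v)).comp_hasDerivAt r h1

theorem schwartz_lineDerivOp_comm (v w : E) (φ : 𝓢(E, ℂ)) : ∂_{v} (∂_{w} φ) = ∂_{w} (∂_{v} φ) := by
  have key : ∀ v w : E, ∀ x, (∂_{v} (∂_{w} φ)) x = fderiv ℝ (fderiv ℝ φ) x v w := fun v w x => by
    have h1 : DifferentiableAt ℝ (fderiv ℝ φ) x :=
      ((φ.smooth ⊤).fderiv_right (m := 1) (by norm_cast)).differentiable (by simp) x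
    rw [SchwartzMap.lineDerivOp_apply_eq_fderiv]
    have e : ((∂_{w} φ : 𝓢(E, ℂ)) : E → ℂ) = fun y => fderiv ℝ φ y w := by
      ext y
      exact SchwartzMap.lineDerivOp_apply_eq_fderiv w φ y
    rw [e, fderiv_clm_apply h1 (differentiableAt_const w)]
    simp
  ext x
  rw [key, key]
  exact (((φ.smooth 2).contDiffAt (x := x)).isSymmSndFDerivAt (by simp)).eq v w

theorem iteratedLineDerivOp_lineDerivOp_comm {n : ℕ} (m : Fin n → E) (v : E) (φ : 𝓢(E, ℂ)) :
    ∂^{m} (∂_{v} φ) = ∂_{v} (∂^{m} φ) := by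
  induction n with
  | zero => simp
  | succ n ih =>
    rw [iteratedLineDerivOp_succ_left, ih, schwartz_lineDerivOp_comm, ← iteratedLineDerivOp_succ_left]

theorem lineDerivOp_translate (v a : E) (φ : 𝓢(E, ℂ)) :
    ∂_{v} (schwartzTranslate a φ) = schwartzTranslate a (∂_{v} φ) := by
  ext x
  rw [schwartzTranslate_apply, SchwartzMap.lineDerivOp_apply_eq_fderiv,
    SchwartzMap.lineDerivOp_apply_eq_fderiv, ← fderiv_comp_add_right]
  congr 2
  ext y
  simp

theorem iteratedLineDerivOp_translate {n : ℕ} (m : Fin n → E) (a : E) (φ : 𝓢(E, ℂ)) :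
    ∂^{m} (schwartzTranslate a φ) = schwartzTranslate a (∂^{m} φ) := by
  induction n with
  | zero => simp
  | succ n ih =>
    rw [iteratedLineDerivOp_succ_left, ih, lineDerivOp_translate, ← iteratedLineDerivOp_succ_left]

theorem lineDerivOp_average (v w : E) (φ : 𝓢(E, ℂ)) :
    ∂_{w} (schwartzAverage v φ) = schwartzAverage v (∂_{w} φ) := by
  simp only [schwartzAverage_eq, lineDerivOp_smul, lineDerivOp_add, lineDerivOp_translate]

/-- The second-order Taylor bound for a function along a line. -/
theorem norm_taylor_remainder_le (χ : 𝓢(E, ℂ)) (x v : E) (δ B : ℝ)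
    (hB : ∀ r : ℝ, |r| ≤ |δ| → ‖(∂_{v} (∂_{v} χ)) (x + r • v)‖ ≤ B) :
    ‖χ (x + δ • v) - χ x - δ • (∂_{v} χ) x‖ ≤ B * δ ^ 2 := by
  have hmem : ∀ r ∈ Set.Icc (-|δ|) |δ|, |r| ≤ |δ| := fun r hr => abs_le.2 hr
  have h0 : (0 : ℝ) ∈ Set.Icc (-|δ|) |δ| := by simp
  have hδ : δ ∈ Set.Icc (-|δ|) |δ| := ⟨neg_abs_le δ, le_abs_self δ⟩
  have h1 : ∀ r ∈ Set.Icc (-|δ|) |δ|, ‖(∂_{v} χ) (x + r • v) - (∂_{v} χ) x‖ ≤ B * |δ| := by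
    intro r hr
    have h := Convex.norm_image_sub_le_of_norm_hasDerivWithin_le
      (f := fun r : ℝ => (∂_{v} χ) (x + r • v)) (s := Set.Icc (-|δ|) |δ|) (C := B)
      (fun y _ => (hasDerivAt_apply_add_smul (∂_{v} χ) x v y).hasDerivWithinAt)
      (fun y hy => hB y (hmem y hy)) (convex_Icc _ _) h0 hr
    have hB0 : 0 ≤ B := (norm_nonneg _).trans (hB 0 (by simp))
    simp only [zero_smul, add_zero, sub_zero] at h
    refine h.trans ?_
    gcongr
    exact hmem r hr
  have h := Convex.norm_image_sub_le_of_norm_hasDerivWithin_le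
      (f := fun r : ℝ => χ (x + r • v) - r • (∂_{v} χ) x) (s := Set.Icc (-|δ|) |δ|)
      (f' := fun r : ℝ => (∂_{v} χ) (x + r • v) - (∂_{v} χ) x) (C := B * |δ|)
      (fun y _ => by
        refine HasDerivAt.hasDerivWithinAt ?_
        refine (hasDerivAt_apply_add_smul χ x v y).sub ?_
        simpa only [id, one_smul] using (hasDerivAt_id y).smul_const ((∂_{v} χ) x))
      h1 (convex_Icc _ _) h0 hδ
  have e : χ (x + δ • v) - χ x - δ • (∂_{v} χ) x =
      χ (x + δ • v) - δ • (∂_{v} χ) x - (χ (x + (0 : ℝ) • v) - (0 : ℝ) • (∂_{v} χ) x) := by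
    simp only [zero_smul, add_zero, sub_zero]
    ring
  rw [e]
  refine h.trans_eq ?_
  rw [sub_zero, Real.norm_eq_abs, mul_assoc, ← pow_two, sq_abs]

theorem schwartzSup_taylor_remainder_le (m : ℕ × ℕ) (φ : 𝓢(E, ℂ)) (v : E) :
    ∃ C : ℝ, 0 ≤ C ∧ ∀ δ : ℝ, |δ| ≤ 1 →
      schwartzSup m (schwartzTranslate (δ • v) φ - φ - (δ : ℂ) • ∂_{v} φ) ≤ C * δ ^ 2 := by
  set Q := schwartzSup (m.1, m.2 + 2) φ with hQ
  have h0 : 0 ≤ Q := apply_nonneg _ _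
  refine ⟨(1 + ‖v‖) ^ m.1 * (2 ^ m.1 * Q) * ‖v‖ ^ 2, by positivity, fun δ hδ => ?_⟩
  refine schwartzSup_le_bound (by positivity) fun k n hk hn x => ?_
  rcases (pow_nonneg (norm_nonneg x) k).eq_or_lt with hx | hx
  · rw [← hx, zero_mul]
    positivity
  rw [← le_div_iff₀' hx]
  refine ContinuousMultilinearMap.opNorm_le_bound (by positivity) fun w => ?_
  rw [← SchwartzMap.iteratedLineDerivOp_eq_iteratedFDeriv]
  have e : (∂^{w} (schwartzTranslate (δ • v) φ - φ - (δ : ℂ) • ∂_{v} φ)) x =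
      (∂^{w} φ) (x + δ • v) - (∂^{w} φ) x - δ • (∂_{v} (∂^{w} φ)) x := by
    simp only [sub_eq_add_neg, iteratedLineDerivOp_add, iteratedLineDerivOp_neg,
      iteratedLineDerivOp_smul, iteratedLineDerivOp_translate,
      iteratedLineDerivOp_lineDerivOp_comm]
    simp
  rw [e]
  refine (norm_taylor_remainder_le (∂^{w} φ) x v δ
    ((1 + ‖v‖) ^ m.1 * (2 ^ m.1 * Q) / ‖x‖ ^ k * (‖v‖ ^ 2 * ∏ i, ‖w i‖)) fun r hr => ?_).trans_eq
      (by ring)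
  -- The second derivative of `∂^{w} φ` is a directional derivative of `φ` of order `n + 2`.
  have e2 : (∂_{v} (∂_{v} (∂^{w} φ))) (x + r • v) =
      iteratedFDeriv ℝ (n + 2) φ (x + r • v) (Fin.cons v (Fin.cons v w)) := by
    rw [← SchwartzMap.iteratedLineDerivOp_eq_iteratedFDeriv, iteratedLineDerivOp_succ_left,
      iteratedLineDerivOp_succ_left]
    simp
  have e3 : ∏ i, ‖(Fin.cons v (Fin.cons v w) : Fin (n + 2) → E) i‖ = ‖v‖ ^ 2 * ∏ i, ‖w i‖ := by
    rw [Fin.prod_univ_succ, Fin.prod_univ_succ]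
    simp
    ring
  rw [e2]
  refine (ContinuousMultilinearMap.le_opNorm _ _).trans ?_
  rw [e3]
  gcongr
  rw [le_div_iff₀' hx]
  have hrv : ‖r • v‖ ≤ ‖v‖ := by
    rw [norm_smul, Real.norm_eq_abs]
    exact mul_le_of_le_one_left (norm_nonneg v) (hr.trans hδ)
  calc ‖x‖ ^ k * ‖iteratedFDeriv ℝ (n + 2) φ (x + r • v)‖
      ≤ ((1 + ‖r • v‖) ^ m.1 * (1 + ‖x + r • v‖) ^ k) *
          ‖iteratedFDeriv ℝ (n + 2) φ (x + r • v)‖ := by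
        gcongr
        exact norm_pow_mul_le_one_add_norm_pow_mul x _ hk
    _ = (1 + ‖r • v‖) ^ m.1 *
          ((1 + ‖x + r • v‖) ^ k * ‖iteratedFDeriv ℝ (n + 2) φ (x + r • v)‖) := by ring
    _ ≤ (1 + ‖v‖) ^ m.1 * (2 ^ m.1 * Q) := by
      refine mul_le_mul (by gcongr) ?_ (by positivity) (by positivity)
      exact one_add_norm_pow_mul_le_schwartzSup (m := (m.1, m.2 + 2)) hk
        (Nat.add_le_add_right hn 2) φ _

/-- Translations are weakly differentiable on Schwartz space. -/
theorem hasDerivAt_schwartzTranslate (Λ : 𝓢(E, ℂ) →L[ℂ] ℂ) (φ : 𝓢(E, ℂ)) (v : E) (s : ℝ) :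
    HasDerivAt (fun s : ℝ => Λ (schwartzTranslate (s • v) φ))
      (Λ (schwartzTranslate (s • v) (∂_{v} φ))) s := by
  set ψ := schwartzTranslate (s • v) φ with hψ
  obtain ⟨m, C, hC, hΛ⟩ := exists_norm_le_schwartzSup Λ
  obtain ⟨D, hD, hT⟩ := schwartzSup_taylor_remainder_le m ψ v
  rw [hasDerivAt_iff_isLittleO_nhds_zero]
  have h1 : (fun δ : ℝ => Λ (schwartzTranslate ((s + δ) • v) φ) - Λ (schwartzTranslate (s • v) φ)
      - δ • Λ (schwartzTranslate (s • v) (∂_{v} φ))) =O[nhds 0] fun δ : ℝ => δ ^ 2 := by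
    refine Asymptotics.IsBigO.of_bound (C * D) ?_
    filter_upwards [Metric.closedBall_mem_nhds (0 : ℝ) one_pos] with δ hδ
    rw [mem_closedBall_zero_iff, Real.norm_eq_abs] at hδ
    have e : Λ (schwartzTranslate ((s + δ) • v) φ) - Λ (schwartzTranslate (s • v) φ)
        - δ • Λ (schwartzTranslate (s • v) (∂_{v} φ)) =
        Λ (schwartzTranslate (δ • v) ψ - ψ - (δ : ℂ) • ∂_{v} ψ) := by
      rw [hψ, schwartzTranslate_translate, lineDerivOp_translate, map_sub, map_sub, map_smul,
        add_smul, add_comm (δ • v)]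
      rfl
    rw [e]
    calc _ ≤ C * schwartzSup m (schwartzTranslate (δ • v) ψ - ψ - (δ : ℂ) • ∂_{v} ψ) := hΛ _
      _ ≤ C * (D * δ ^ 2) := by
        gcongr
        exact hT δ hδ
      _ = C * D * ‖δ ^ 2‖ := by
        rw [norm_pow, Real.norm_eq_abs, sq_abs]
        ring
  refine h1.trans_isLittleO ?_
  simpa using Asymptotics.isLittleO_pow_pow (𝕜 := ℝ) (m := 1) (n := 2) (by norm_num)

end Translation

/-! ### Poisson weights -/

section Poisson

open scoped Nat

/-- The Poisson weight `e^{-a} a^k / k!`, for every real `a`. -/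
def poissonWeight (a : ℝ) (k : ℕ) : ℝ := Real.exp (-a) * (a ^ k / k !)

theorem poissonWeight_nonneg {a : ℝ} (ha : 0 ≤ a) (k : ℕ) : 0 ≤ poissonWeight a k := by
  unfold poissonWeight
  positivity

theorem poissonWeight_zero (k : ℕ) : poissonWeight 0 k = if k = 0 then 1 else 0 := by
  rcases k with _ | k <;> simp [poissonWeight]

theorem hasSum_poissonWeight (a : ℝ) : HasSum (poissonWeight a) 1 := by
  have h := (NormedSpace.expSeries_div_hasSum_exp a).mul_left (Real.exp (-a))
  rwa [← Real.exp_eq_exp_ℝ, ← Real.exp_add, neg_add_cancel, Real.exp_zero] at h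

theorem succ_mul_poissonWeight_succ (a : ℝ) (k : ℕ) :
    ((k : ℝ) + 1) * poissonWeight a (k + 1) = a * poissonWeight a k := by
  have h1 : (k ! : ℝ) ≠ 0 := by positivity
  have h2 : (k : ℝ) + 1 ≠ 0 := by positivity
  simp only [poissonWeight, Nat.factorial_succ]
  push_cast
  field_simp
  ring

theorem summable_pow_div_factorial_mul_pow (a : ℝ) (N : ℕ) :
    Summable fun k : ℕ => a ^ k / k ! * ((k : ℝ) + 1) ^ N := by
  have h := (Real.summable_pow_div_factorial (|a| * Real.exp 1)).mul_left (N ! * Real.exp 1)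
  refine Summable.of_norm_bounded h fun k => ?_
  have h1 : ((k : ℝ) + 1) ^ N ≤ N ! * Real.exp (k + 1) := by
    have := Real.pow_div_factorial_le_exp ((k : ℝ) + 1) (by positivity) N
    rwa [div_le_iff₀' (by positivity)] at this
  have h2 : Real.exp ((k : ℝ) + 1) = Real.exp 1 ^ k * Real.exp 1 := by
    rw [Real.exp_add, ← Real.exp_nat_mul, mul_one]
  rw [h2] at h1
  rw [norm_mul, norm_div, norm_pow, norm_pow, Real.norm_eq_abs, Real.norm_of_nonneg (by positivity),
    Real.norm_of_nonneg (by positivity), mul_pow]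
  calc |a| ^ k / k ! * ((k : ℝ) + 1) ^ N
      ≤ |a| ^ k / k ! * (N ! * (Real.exp 1 ^ k * Real.exp 1)) := by gcongr
    _ = _ := by ring

theorem summable_poissonWeight_mul_pow (a : ℝ) (N : ℕ) :
    Summable fun k : ℕ => poissonWeight a k * ((k : ℝ) + 1) ^ N := by
  simpa only [poissonWeight, mul_assoc] using
    (summable_pow_div_factorial_mul_pow a N).mul_left (Real.exp (-a))

/-- The moments of the Poisson law grow polynomially in its parameter. -/
theorem exists_tsum_poissonWeight_mul_pow_le (N : ℕ) :
    ∃ C : ℝ, 0 ≤ C ∧ ∀ a : ℝ, 0 ≤ a →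
      ∑' k : ℕ, poissonWeight a k * ((k : ℝ) + 1) ^ N ≤ C * (1 + a) ^ N := by
  induction N with
  | zero => exact ⟨1, one_pos.le, fun a _ => by simp [(hasSum_poissonWeight a).tsum_eq]⟩
  | succ N ih =>
    obtain ⟨C, hC, h⟩ := ih
    refine ⟨2 ^ N * C, by positivity, fun a ha => ?_⟩
    set m := ∑' k : ℕ, poissonWeight a k * ((k : ℝ) + 1) ^ N with hm
    have hs := summable_poissonWeight_mul_pow a N
    have hterm : ∀ k, 0 ≤ poissonWeight a k * ((k : ℝ) + 1) ^ N := fun k =>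
      mul_nonneg (poissonWeight_nonneg ha k) (by positivity)
    have hm0 : 0 ≤ m := tsum_nonneg hterm
    have hs' : Summable fun k : ℕ => (k : ℝ) * (poissonWeight a k * ((k : ℝ) + 1) ^ N) := by
      refine ((summable_poissonWeight_mul_pow a (N + 1)).sub hs).congr fun k => ?_
      ring
    have e1 : ∑' k : ℕ, poissonWeight a k * ((k : ℝ) + 1) ^ (N + 1) =
        ∑' k : ℕ, (k : ℝ) * (poissonWeight a k * ((k : ℝ) + 1) ^ N) + m := by
      rw [hm, ← hs'.tsum_add hs]
      exact tsum_congr fun k => by ring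
    have e2 : ∑' k : ℕ, (k : ℝ) * (poissonWeight a k * ((k : ℝ) + 1) ^ N) ≤ a * 2 ^ N * m := by
      rw [hs'.tsum_eq_zero_add, hm, ← tsum_mul_left]
      simp only [Nat.cast_zero, zero_mul, zero_add]
      refine Summable.tsum_le_tsum (fun k => ?_) ((summable_nat_add_iff 1).2 hs')
        (hs.mul_left _)
      have e3 : ((k + 1 : ℕ) : ℝ) * (poissonWeight a (k + 1) * (((k + 1 : ℕ) : ℝ) + 1) ^ N) =
          a * poissonWeight a k * ((k : ℝ) + 1 + 1) ^ N := by
        push_cast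
        rw [← mul_assoc, succ_mul_poissonWeight_succ]
      rw [e3]
      calc a * poissonWeight a k * ((k : ℝ) + 1 + 1) ^ N
          ≤ a * poissonWeight a k * (2 * ((k : ℝ) + 1)) ^ N := by
            refine mul_le_mul_of_nonneg_left ?_ (mul_nonneg ha (poissonWeight_nonneg ha k))
            gcongr
            linarith [(Nat.cast_nonneg k : (0 : ℝ) ≤ k)]
        _ = _ := by
          rw [mul_pow]
          ring
    rw [e1]
    have h1 : (1 : ℝ) ≤ 2 ^ N := one_le_pow₀ (by norm_num)
    calc _ ≤ a * 2 ^ N * m + m := by linarith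
      _ ≤ 2 ^ N * (1 + a) * m := by nlinarith
      _ ≤ 2 ^ N * (1 + a) * (C * (1 + a) ^ N) := by
        gcongr
        exact h a ha
      _ = _ := by ring

theorem norm_poissonWeight_le {a A : ℝ} (h : |a| ≤ A) (k : ℕ) :
    ‖poissonWeight a k‖ ≤ Real.exp A * (A ^ k / k !) := by
  rw [poissonWeight, norm_mul, norm_div, norm_pow, Real.norm_eq_abs, Real.norm_eq_abs,
    Real.norm_eq_abs, Real.abs_exp, Nat.abs_cast]
  gcongr
  exact (neg_le_abs a).trans h

theorem hasDerivAt_poissonWeight (lam s : ℝ) (k : ℕ) :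
    HasDerivAt (fun s => poissonWeight (lam * s) k)
      (lam * (Real.exp (-(lam * s)) * (k * (lam * s) ^ (k - 1) / k !) - poissonWeight (lam * s) k))
      s := by
  have h1 : HasDerivAt (fun s : ℝ => lam * s) lam s := by
    simpa using (hasDerivAt_id s).const_mul lam
  refine (h1.neg.exp.mul ((h1.pow k).div_const (k ! : ℝ))).congr_deriv ?_
  simp only [poissonWeight, Pi.pow_apply, Pi.neg_apply]
  ring

/-- Differentiation of a series with Poisson weights of parameter `lam * s`: the derivative of the
weights becomes a difference of consecutive coefficients. -/
theorem hasDerivAt_tsum_poissonWeight {F : Type*} [NormedAddCommGroup F] [NormedSpace ℝ F]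
    [CompleteSpace F] (lam : ℝ) {b b' : ℕ → ℝ → F} (hb : ∀ k s, HasDerivAt (b k) (b' k s) s)
    (hgrowth : ∀ R : ℝ, ∃ (C : ℝ) (N : ℕ), ∀ k s, |s| ≤ R →
      ‖b k s‖ ≤ C * ((k : ℝ) + 1) ^ N ∧ ‖b' k s‖ ≤ C * ((k : ℝ) + 1) ^ N) (s : ℝ) :
    HasDerivAt (fun s => ∑' k, poissonWeight (lam * s) k • b k s)
      (∑' k, poissonWeight (lam * s) k • (b' k s + lam • (b (k + 1) s - b k s))) s := by
  set R := |s| + 1 with hR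
  obtain ⟨C, N, hC⟩ := hgrowth R
  have hC0 : 0 ≤ C := by
    have := (norm_nonneg _).trans (hC 0 0 (by rw [abs_zero]; positivity)).1
    simpa using this
  set A := |lam| * R + 1 with hA
  have hA1 : 1 ≤ A := by
    rw [hA]
    nlinarith [mul_nonneg (abs_nonneg lam) (show 0 ≤ R by positivity)]
  have hla : ∀ y ∈ Metric.ball (0 : ℝ) R, |y| ≤ R ∧ |lam * y| ≤ A := by
    intro y hy
    rw [mem_ball_zero_iff, Real.norm_eq_abs] at hy
    refine ⟨hy.le, ?_⟩
    rw [abs_mul, hA]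
    nlinarith [abs_nonneg lam]
  -- A derivative of a weight costs one more power of `k + 1`.
  set c : ℕ → ℝ → ℝ := fun k y => Real.exp (-(lam * y)) * (k * (lam * y) ^ (k - 1) / k !) with hc
  have hcb : ∀ k y, y ∈ Metric.ball (0 : ℝ) R →
      ‖c k y‖ ≤ Real.exp A * (A ^ k / k !) * ((k : ℝ) + 1) := by
    intro k y hy
    rw [hc]
    simp only [norm_mul, norm_div, norm_pow, Real.norm_eq_abs, Real.abs_exp, Nat.abs_cast]
    have h1 : |lam * y| ^ (k - 1) ≤ A ^ k :=
      (pow_le_pow_left₀ (abs_nonneg _) (hla y hy).2 _).trans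
        (pow_le_pow_right₀ hA1 (Nat.sub_le k 1))
    calc _ ≤ Real.exp A * (((k : ℝ) + 1) * A ^ k / k !) := by
          rw [← abs_mul]
          gcongr
          · exact (neg_le_abs _).trans (hla y hy).2
          · linarith
      _ = _ := by ring
  have hwb : ∀ k y, y ∈ Metric.ball (0 : ℝ) R →
      ‖poissonWeight (lam * y) k‖ ≤ Real.exp A * (A ^ k / k !) * ((k : ℝ) + 1) := by
    intro k y hy
    refine (norm_poissonWeight_le (hla y hy).2 k).trans (le_mul_of_one_le_right ?_ ?_)
    · positivity
    · linarith [(Nat.cast_nonneg k : (0 : ℝ) ≤ k)]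
  have hsum : ∀ D : ℝ, Summable fun k : ℕ =>
      D * (A ^ k / k ! * ((k : ℝ) + 1) ^ (N + 1)) := fun D =>
    (summable_pow_div_factorial_mul_pow A (N + 1)).mul_left D
  have hs : s ∈ Metric.ball (0 : ℝ) R := by
    rw [mem_ball_zero_iff, Real.norm_eq_abs]
    linarith
  have hmul : ∀ (x : ℝ) (z : F) (k : ℕ), ‖x‖ ≤ Real.exp A * (A ^ k / k !) * ((k : ℝ) + 1) →
      ‖z‖ ≤ C * ((k : ℝ) + 1) ^ N →
      ‖x • z‖ ≤ Real.exp A * C * (A ^ k / k ! * ((k : ℝ) + 1) ^ (N + 1)) := by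
    intro x z k hx hz
    rw [norm_smul]
    calc ‖x‖ * ‖z‖ ≤ (Real.exp A * (A ^ k / k !) * ((k : ℝ) + 1)) * (C * ((k : ℝ) + 1) ^ N) := by
          gcongr
      _ = _ := by ring
  have hder := hasDerivAt_tsum_of_isPreconnected (𝕜 := ℝ)
    (g := fun k y => poissonWeight (lam * y) k • b k y)
    (g' := fun k y => poissonWeight (lam * y) k • b' k y +
      (lam * (c k y - poissonWeight (lam * y) k)) • b k y)
    (hsum (Real.exp A * C * (1 + 2 * |lam|))) Metric.isOpen_ball
    (convex_ball (0 : ℝ) R).isPreconnected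
    (fun k y _ => (hasDerivAt_poissonWeight lam y k).smul (hb k y))
    (fun k y hy => by
      have h1 := hmul _ _ k (hwb k y hy) (hC k y (hla y hy).1).2
      have h2 := hmul _ _ k (hwb k y hy) (hC k y (hla y hy).1).1
      have h3 := hmul _ _ k (hcb k y hy) (hC k y (hla y hy).1).1
      have h4 : ‖(lam * (c k y - poissonWeight (lam * y) k)) • b k y‖ ≤
          |lam| * (‖c k y • b k y‖ + ‖poissonWeight (lam * y) k • b k y‖) := by
        rw [mul_smul, norm_smul, Real.norm_eq_abs, sub_smul]
        gcongr
        exact norm_sub_le _ _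
      refine (norm_add_le _ _).trans ?_
      nlinarith [abs_nonneg lam])
    hs
    (Summable.of_norm_bounded (hsum (Real.exp A * C))
      fun k => hmul _ _ k (hwb k s hs) (hC k s (hla s hs).1).1) hs
  refine hder.congr_deriv ?_
  have s1 : Summable fun k => poissonWeight (lam * s) k • b' k s :=
    Summable.of_norm_bounded (hsum (Real.exp A * C))
      fun k => hmul _ _ k (hwb k s hs) (hC k s (hla s hs).1).2
  have s2 : Summable fun k => poissonWeight (lam * s) k • b k s :=
    Summable.of_norm_bounded (hsum (Real.exp A * C))
      fun k => hmul _ _ k (hwb k s hs) (hC k s (hla s hs).1).1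
  have s3 : Summable fun k => c k s • b k s :=
    Summable.of_norm_bounded (hsum (Real.exp A * C))
      fun k => hmul _ _ k (hcb k s hs) (hC k s (hla s hs).1).1
  have hc0 : c 0 s = 0 := by simp [hc]
  have hc1 : ∀ k, c (k + 1) s = poissonWeight (lam * s) k := by
    intro k
    have h1 : (k ! : ℝ) ≠ 0 := by positivity
    have h2 : (k : ℝ) + 1 ≠ 0 := by positivity
    simp only [hc, poissonWeight, Nat.factorial_succ, Nat.add_sub_cancel]
    push_cast
    field_simp
  have s4 : Summable fun k => poissonWeight (lam * s) k • b (k + 1) s := by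
    simpa only [hc1] using (summable_nat_add_iff 1).2 s3
  have e3 : ∑' k, c k s • b k s = ∑' k, poissonWeight (lam * s) k • b (k + 1) s := by
    rw [s3.tsum_eq_zero_add, hc0, zero_smul, zero_add]
    simp only [hc1]
  calc ∑' k, (poissonWeight (lam * s) k • b' k s +
        (lam * (c k s - poissonWeight (lam * s) k)) • b k s)
      = ∑' k, (poissonWeight (lam * s) k • b' k s +
        lam • (c k s • b k s - poissonWeight (lam * s) k • b k s)) :=
        tsum_congr fun k => by rw [mul_smul, sub_smul]
    _ = ∑' k, poissonWeight (lam * s) k • b' k s +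
        lam • (∑' k, poissonWeight (lam * s) k • b (k + 1) s -
          ∑' k, poissonWeight (lam * s) k • b k s) := by
      rw [s1.tsum_add ((s3.sub s2).const_smul lam), (s3.sub s2).tsum_const_smul, s3.tsum_sub s2, e3]
    _ = _ := by
      rw [← s4.tsum_sub s2, ← (s4.sub s2).tsum_const_smul,
        ← s1.tsum_add ((s4.sub s2).const_smul lam)]
      refine tsum_congr fun k => ?_
      rw [smul_add, smul_comm _ lam, smul_sub (poissonWeight _ _)]

end Poisson

/-! ### Evolution of a functional along translations -/

section Pairing

variable {E : Type*} [NormedAddCommGroup E] [NormedSpace ℝ E]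

/-- The pairing of a functional `Λ` with the test function obtained from `φ` by a translation along
`s • e` and a Poisson number, of parameter `lam * s`, of averages in the direction `v`. Formally it
is `Λ (exp (s (∂_{e} + lam (average - 1))) φ)`. -/
def poissonPairing (lam : ℝ) (v e : E) (Λ : 𝓢(E, ℂ) →L[ℂ] ℂ) (φ : 𝓢(E, ℂ)) (s : ℝ) : ℂ :=
  ∑' k, poissonWeight (lam * s) k •
    Λ ((schwartzAverage v ^ k) (schwartzTranslate (s • e) φ))

/-- The generator `∂_{e} + lam (average - 1)` of the evolution of test functions. -/
def evolutionGenerator (lam : ℝ) (v e : E) (φ : 𝓢(E, ℂ)) : 𝓢(E, ℂ) :=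
  ∂_{e} φ + (lam : ℂ) • (schwartzAverage v φ - φ)

theorem exists_norm_apply_average_pow_translate_le (v e : E) (Λ : 𝓢(E, ℂ) →L[ℂ] ℂ) :
    ∃ (m : ℕ × ℕ) (C : ℝ), 0 ≤ C ∧ ∀ (φ : 𝓢(E, ℂ)) (k : ℕ) (s : ℝ),
      ‖Λ ((schwartzAverage v ^ k) (schwartzTranslate (s • e) φ))‖ ≤
        C * schwartzSup m φ * (1 + |s|) ^ m.1 * ((k : ℝ) + 1) ^ m.1 := by
  obtain ⟨m, C, hC, h⟩ := exists_norm_le_schwartzSup Λ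
  refine ⟨m, C * (1 + ‖e‖ + ‖v‖) ^ m.1 * 2 ^ m.1, by positivity, fun φ k s => ?_⟩
  have h0 : 0 ≤ schwartzSup m φ := apply_nonneg _ _
  have h1 : 1 + ‖s • e‖ + k * ‖v‖ ≤ (1 + ‖e‖ + ‖v‖) * (1 + |s|) * ((k : ℝ) + 1) := by
    rw [norm_smul, Real.norm_eq_abs]
    have hs := abs_nonneg s
    have he := norm_nonneg e
    have hv := norm_nonneg v
    have hk : (0 : ℝ) ≤ k := Nat.cast_nonneg k
    nlinarith [mul_nonneg hs he, mul_nonneg hs hv, mul_nonneg hs hk, mul_nonneg he hk,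
      mul_nonneg hv hk, mul_nonneg (mul_nonneg hs he) hk, mul_nonneg (mul_nonneg hs hv) hk]
  calc _ ≤ C * schwartzSup m ((schwartzAverage v ^ k) (schwartzTranslate (s • e) φ)) := h _
    _ ≤ C * ((1 + ‖s • e‖ + k * ‖v‖) ^ m.1 * (2 ^ m.1 * schwartzSup m φ)) := by
      gcongr
      exact schwartzSup_average_pow_translate_le m v _ k φ
    _ ≤ C * (((1 + ‖e‖ + ‖v‖) * (1 + |s|) * ((k : ℝ) + 1)) ^ m.1 *
          (2 ^ m.1 * schwartzSup m φ)) := by gcongr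
    _ = _ := by
      rw [mul_pow, mul_pow]
      ring

theorem summable_poissonPairing (lam : ℝ) (v e : E) (Λ : 𝓢(E, ℂ) →L[ℂ] ℂ) (φ : 𝓢(E, ℂ)) (s : ℝ) :
    Summable fun k => poissonWeight (lam * s) k •
      Λ ((schwartzAverage v ^ k) (schwartzTranslate (s • e) φ)) := by
  obtain ⟨m, C, hC, h⟩ := exists_norm_apply_average_pow_translate_le v e Λ
  refine Summable.of_norm_bounded
    ((summable_poissonWeight_mul_pow (lam * s) m.1).norm.mul_left
      (C * schwartzSup m φ * (1 + |s|) ^ m.1)) fun k => ?_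
  rw [norm_smul, norm_mul, Real.norm_of_nonneg (show 0 ≤ ((k : ℝ) + 1) ^ m.1 by positivity)]
  calc _ ≤ ‖poissonWeight (lam * s) k‖ *
        (C * schwartzSup m φ * (1 + |s|) ^ m.1 * ((k : ℝ) + 1) ^ m.1) := by
        gcongr
        exact h φ k s
    _ = _ := by ring

theorem poissonPairing_add (lam : ℝ) (v e : E) (Λ : 𝓢(E, ℂ) →L[ℂ] ℂ) (φ ψ : 𝓢(E, ℂ)) (s : ℝ) :
    poissonPairing lam v e Λ (φ + ψ) s =
      poissonPairing lam v e Λ φ s + poissonPairing lam v e Λ ψ s := by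
  rw [poissonPairing, poissonPairing, poissonPairing,
    ← (summable_poissonPairing lam v e Λ φ s).tsum_add (summable_poissonPairing lam v e Λ ψ s)]
  exact tsum_congr fun k => by simp only [map_add, smul_add]

theorem poissonPairing_smul (lam : ℝ) (v e : E) (Λ : 𝓢(E, ℂ) →L[ℂ] ℂ) (c : ℂ) (φ : 𝓢(E, ℂ))
    (s : ℝ) : poissonPairing lam v e Λ (c • φ) s = c • poissonPairing lam v e Λ φ s := by
  rw [poissonPairing, poissonPairing, ← (summable_poissonPairing lam v e Λ φ s).tsum_const_smul]
  exact tsum_congr fun k => by rw [map_smul, map_smul, map_smul, smul_comm]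

theorem poissonPairing_zero (lam : ℝ) (v e : E) (Λ : 𝓢(E, ℂ) →L[ℂ] ℂ) (φ : 𝓢(E, ℂ)) :
    poissonPairing lam v e Λ φ 0 = Λ φ := by
  rw [poissonPairing, tsum_eq_single 0 fun k hk => by simp [poissonWeight_zero, hk]]
  simp [poissonWeight_zero]

/-- The Kolmogorov equation for the evolution of test functions. -/
theorem hasDerivAt_poissonPairing (lam : ℝ) (v e : E) (Λ : 𝓢(E, ℂ) →L[ℂ] ℂ) (φ : 𝓢(E, ℂ)) (s : ℝ) :
    HasDerivAt (poissonPairing lam v e Λ φ)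
      (poissonPairing lam v e Λ (evolutionGenerator lam v e φ) s) s := by
  obtain ⟨m, C, hC, h⟩ := exists_norm_apply_average_pow_translate_le v e Λ
  have hder := hasDerivAt_tsum_poissonWeight lam
    (b := fun k s => Λ ((schwartzAverage v ^ k) (schwartzTranslate (s • e) φ)))
    (b' := fun k s => Λ ((schwartzAverage v ^ k) (schwartzTranslate (s • e) (∂_{e} φ))))
    (fun k s => hasDerivAt_schwartzTranslate (Λ ∘L (schwartzAverage v ^ k)) φ e s)
    (fun R => by
      refine ⟨C * (schwartzSup m φ + schwartzSup m (∂_{e} φ)) * (1 + R) ^ m.1, m.1,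
        fun k s hs => ?_⟩
      have h1 : 0 ≤ schwartzSup m φ := apply_nonneg _ _
      have h2 : 0 ≤ schwartzSup m (∂_{e} φ) := apply_nonneg _ _
      have hR : 0 ≤ R := (abs_nonneg s).trans hs
      constructor
      · refine (h φ k s).trans ?_
        gcongr
        linarith
      · refine (h (∂_{e} φ) k s).trans ?_
        gcongr
        linarith) s
  refine hder.congr_deriv ?_
  rw [poissonPairing]
  refine tsum_congr fun k => ?_
  congr 1
  have e1 : (schwartzAverage v ^ (k + 1)) (schwartzTranslate (s • e) φ) =
      (schwartzAverage v ^ k) (schwartzTranslate (s • e) (schwartzAverage v φ)) := by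
    rw [pow_succ, mul_apply_eq_comp, schwartzAverage_translate]
  simp only [e1, evolutionGenerator, map_add, map_sub, map_smul]
  rfl

theorem exists_norm_poissonPairing_le {lam : ℝ} (hlam : 0 ≤ lam) (v e : E)
    (Λ : 𝓢(E, ℂ) →L[ℂ] ℂ) :
    ∃ (m : ℕ × ℕ) (C : ℝ), 0 ≤ C ∧ ∀ (φ : 𝓢(E, ℂ)) (s : ℝ), 0 ≤ s →
      ‖poissonPairing lam v e Λ φ s‖ ≤ C * (1 + s ^ 2) ^ m.1 * schwartzSup m φ := by
  obtain ⟨m, C, hC, h⟩ := exists_norm_apply_average_pow_translate_le v e Λ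
  obtain ⟨D, hD, hmom⟩ := exists_tsum_poissonWeight_mul_pow_le m.1
  refine ⟨m, C * D * (2 * (1 + lam)) ^ m.1, by positivity, fun φ s hs => ?_⟩
  have h0 : 0 ≤ schwartzSup m φ := apply_nonneg _ _
  have hls : 0 ≤ lam * s := mul_nonneg hlam hs
  have hb : ∀ k, ‖poissonWeight (lam * s) k •
      Λ ((schwartzAverage v ^ k) (schwartzTranslate (s • e) φ))‖ ≤
      C * schwartzSup m φ * (1 + s) ^ m.1 *
        (poissonWeight (lam * s) k * ((k : ℝ) + 1) ^ m.1) := fun k => by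
    have h1 := poissonWeight_nonneg hls k
    rw [norm_smul, Real.norm_of_nonneg h1]
    have h2 := h φ k s
    rw [abs_of_nonneg hs] at h2
    calc _ ≤ poissonWeight (lam * s) k *
          (C * schwartzSup m φ * (1 + s) ^ m.1 * ((k : ℝ) + 1) ^ m.1) := by gcongr
      _ = _ := by ring
  have h1 : (1 + s) * (1 + lam * s) ≤ 2 * (1 + lam) * (1 + s ^ 2) := by
    nlinarith [sq_nonneg (s - 1), mul_nonneg hlam (sq_nonneg (s - 1)),
      mul_nonneg hlam (sq_nonneg s)]
  calc ‖poissonPairing lam v e Λ φ s‖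
      ≤ ∑' k, C * schwartzSup m φ * (1 + s) ^ m.1 *
        (poissonWeight (lam * s) k * ((k : ℝ) + 1) ^ m.1) :=
        tsum_of_norm_bounded
          ((summable_poissonWeight_mul_pow (lam * s) m.1).mul_left _).hasSum hb
    _ ≤ C * schwartzSup m φ * (1 + s) ^ m.1 * (D * (1 + lam * s) ^ m.1) := by
      rw [tsum_mul_left]
      gcongr
      exact hmom _ hls
    _ = C * schwartzSup m φ * D * ((1 + s) * (1 + lam * s)) ^ m.1 := by
      rw [mul_pow]
      ring
    _ ≤ C * schwartzSup m φ * D * (2 * (1 + lam) * (1 + s ^ 2)) ^ m.1 := by gcongr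
    _ = _ := by
      rw [mul_pow (2 * (1 + lam))]
      ring

theorem evolutionGenerator_average (lam : ℝ) (v e : E) (φ : 𝓢(E, ℂ)) :
    evolutionGenerator lam v e (schwartzAverage v φ) =
      schwartzAverage v (evolutionGenerator lam v e φ) := by
  simp only [evolutionGenerator, map_add, map_smul, map_sub, lineDerivOp_average]

theorem evolutionGenerator_translate (lam : ℝ) (v e a : E) (φ : 𝓢(E, ℂ)) :
    evolutionGenerator lam v e (schwartzTranslate a φ) =
      schwartzTranslate a (evolutionGenerator lam v e φ) := by
  simp only [evolutionGenerator, map_add, map_smul, map_sub, lineDerivOp_translate,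
    schwartzAverage_translate]

/-- If `Λ` annihilates the range of the generator, then it is invariant under the evolution. -/
theorem poissonPairing_eq_of_generator {lam : ℝ} {v e : E} {Λ : 𝓢(E, ℂ) →L[ℂ] ℂ}
    (hΛ : ∀ φ, Λ (evolutionGenerator lam v e φ) = 0) (φ : 𝓢(E, ℂ)) (s : ℝ) :
    poissonPairing lam v e Λ φ s = Λ φ := by
  have hcomm : ∀ k ψ, (schwartzAverage v ^ k) (evolutionGenerator lam v e ψ) =
      evolutionGenerator lam v e ((schwartzAverage v ^ k) ψ) := by
    intro k
    induction k with
    | zero => simp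
    | succ k ih =>
      intro ψ
      rw [pow_succ', mul_apply_eq_comp, ih, ← evolutionGenerator_average, mul_apply_eq_comp]
  have h0 : ∀ s, HasDerivAt (poissonPairing lam v e Λ φ) 0 s := fun s => by
    refine (hasDerivAt_poissonPairing lam v e Λ φ s).congr_deriv ?_
    rw [poissonPairing]
    refine (tsum_congr fun k => ?_).trans tsum_zero
    rw [← evolutionGenerator_translate, hcomm, hΛ, smul_zero]
  rw [← poissonPairing_zero lam v e Λ φ]
  exact is_const_of_deriv_eq_zero (fun s => (h0 s).differentiableAt) (fun s => (h0 s).deriv) _ _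

end Pairing

/-! ### The time integral of the evolution -/

section Existence

/-- The time slice as a continuous linear map. -/
def timeSliceCLM (t : ℝ) : 𝓢(ℝ × ℝ, ℂ) →L[ℂ] 𝓢(ℝ, ℂ) :=
  SchwartzMap.compCLMOfAntilipschitz (K := 1) ℂ (g := fun x : ℝ => (t, x))
    (by
      have e : (fun x : ℝ => (t, x)) =
          fun x : ℝ => ((t, 0) : ℝ × ℝ) + ContinuousLinearMap.inr ℝ ℝ ℝ x := by
        funext x
        simp
      rw [e]
      fun_prop)
    (fun x y => by simp [Prod.edist_eq])

theorem timeSliceCLM_eq (t : ℝ) (φ : 𝓢(ℝ × ℝ, ℂ)) : timeSliceCLM t φ = timeSlice t φ := rfl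

theorem timeSlice_average_pow (h t : ℝ) (k : ℕ) (φ : 𝓢(ℝ × ℝ, ℂ)) :
    timeSlice t ((schwartzAverage ((0, h) : ℝ × ℝ) ^ k) φ) =
      (schwartzAverage h ^ k) (timeSlice t φ) := by
  induction k with
  | zero => simp
  | succ k ih =>
    rw [pow_succ', pow_succ', mul_apply_eq_comp, mul_apply_eq_comp, ← ih]
    ext x
    simp [timeSlice_apply, schwartzAverage_apply]

theorem timeSlice_zero_average_pow_translate (h s : ℝ) (k : ℕ) (φ : 𝓢(ℝ × ℝ, ℂ)) :
    timeSlice 0 ((schwartzAverage ((0, h) : ℝ × ℝ) ^ k)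
      (schwartzTranslate (s • ((1, 0) : ℝ × ℝ)) φ)) = (schwartzAverage h ^ k) (timeSlice s φ) := by
  rw [timeSlice_average_pow]
  congr 1
  ext x
  simp [timeSlice_apply]

/-- The pairing at time `s` of the evolution with a test function on space-time. -/
def slicePairing (lam h : ℝ) (Λ : 𝓢(ℝ, ℂ) →L[ℂ] ℂ) (φ : 𝓢(ℝ × ℝ, ℂ)) (s : ℝ) : ℂ :=
  poissonPairing lam ((0, h) : ℝ × ℝ) (1, 0) (Λ ∘L timeSliceCLM 0) φ s

theorem slicePairing_eq_tsum (lam h : ℝ) (Λ : 𝓢(ℝ, ℂ) →L[ℂ] ℂ) (φ : 𝓢(ℝ × ℝ, ℂ)) (s : ℝ) :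
    slicePairing lam h Λ φ s =
      ∑' k, poissonWeight (lam * s) k • Λ ((schwartzAverage h ^ k) (timeSlice s φ)) := by
  rw [slicePairing, poissonPairing]
  simp only [ContinuousLinearMap.comp_apply, timeSliceCLM_eq, timeSlice_zero_average_pow_translate]

/-- Multiplication of a test function by the weight `(1 + t²)ⁿ`. -/
def timeWeight (n : ℕ) : 𝓢(ℝ × ℝ, ℂ) →L[ℂ] 𝓢(ℝ × ℝ, ℂ) :=
  SchwartzMap.smulLeftCLM ℂ fun z : ℝ × ℝ => (((1 + z.1 ^ 2) ^ n : ℝ) : ℂ)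

theorem timeWeight_apply (n : ℕ) (φ : 𝓢(ℝ × ℝ, ℂ)) (z : ℝ × ℝ) :
    timeWeight n φ z = (((1 + z.1 ^ 2) ^ n : ℝ) : ℂ) * φ z := by
  have hg : (fun z : ℝ × ℝ => (((1 + z.1 ^ 2) ^ n : ℝ) : ℂ)).HasTemperateGrowth := by
    have h0 : (fun z : ℝ × ℝ => z.1).HasTemperateGrowth :=
      (ContinuousLinearMap.fst ℝ ℝ ℝ).hasTemperateGrowth
    have h1 : (fun z : ℝ × ℝ => (1 + z.1 ^ 2) ^ n).HasTemperateGrowth := by fun_prop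
    fun_prop
  rw [timeWeight, SchwartzMap.smulLeftCLM_apply_apply hg, smul_eq_mul]

theorem slicePairing_timeWeight (lam h : ℝ) (Λ : 𝓢(ℝ, ℂ) →L[ℂ] ℂ) (n : ℕ) (φ : 𝓢(ℝ × ℝ, ℂ))
    (s : ℝ) : slicePairing lam h Λ (timeWeight n φ) s =
      (((1 + s ^ 2) ^ n : ℝ) : ℂ) * slicePairing lam h Λ φ s := by
  have e : timeSlice s (timeWeight n φ) = (((1 + s ^ 2) ^ n : ℝ) : ℂ) • timeSlice s φ := by
    ext x
    simp only [timeSlice_apply, timeWeight_apply, smul_apply, smul_eq_mul]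
  rw [slicePairing_eq_tsum, slicePairing_eq_tsum, e, ← tsum_mul_left]
  refine tsum_congr fun k => ?_
  rw [map_smul, map_smul, smul_eq_mul, mul_smul_comm]

theorem hasDerivAt_slicePairing (lam h : ℝ) (Λ : 𝓢(ℝ, ℂ) →L[ℂ] ℂ) (φ : 𝓢(ℝ × ℝ, ℂ)) (s : ℝ) :
    HasDerivAt (slicePairing lam h Λ φ)
      (slicePairing lam h Λ (evolutionGenerator lam (0, h) (1, 0) φ) s) s :=
  hasDerivAt_poissonPairing lam _ _ _ φ s

theorem continuous_slicePairing (lam h : ℝ) (Λ : 𝓢(ℝ, ℂ) →L[ℂ] ℂ) (φ : 𝓢(ℝ × ℝ, ℂ)) :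
    Continuous (slicePairing lam h Λ φ) :=
  continuous_iff_continuousAt.2 fun s => (hasDerivAt_slicePairing lam h Λ φ s).continuousAt

/-- The decay in time of test functions, obtained by trading a power of `1 + t²`, beats the
polynomial growth of the pairing. -/
theorem exists_norm_slicePairing_le {lam : ℝ} (hlam : 0 ≤ lam) (h : ℝ) (Λ : 𝓢(ℝ, ℂ) →L[ℂ] ℂ) :
    ∃ (m : ℕ × ℕ) (C : ℝ), 0 ≤ C ∧ ∀ (φ : 𝓢(ℝ × ℝ, ℂ)) (s : ℝ), 0 ≤ s →
      ‖slicePairing lam h Λ φ s‖ ≤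
        C * schwartzSup m (timeWeight (m.1 + 1) φ) * (1 + s ^ 2)⁻¹ := by
  obtain ⟨m, C, hC, hb⟩ := exists_norm_poissonPairing_le hlam ((0, h) : ℝ × ℝ) (1, 0)
    (Λ ∘L timeSliceCLM 0)
  refine ⟨m, C, hC, fun φ s hs => ?_⟩
  have h1 := hb (timeWeight (m.1 + 1) φ) s hs
  have hp : 0 < 1 + s ^ 2 := by positivity
  change ‖slicePairing lam h Λ (timeWeight (m.1 + 1) φ) s‖ ≤ _ at h1
  rw [slicePairing_timeWeight, norm_mul, Complex.norm_real, Real.norm_of_nonneg (by positivity),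
    pow_succ, mul_assoc, mul_comm C, mul_assoc] at h1
  have h2 := le_of_mul_le_mul_left h1 (pow_pos hp m.1)
  rwa [← le_div_iff₀' hp, div_eq_mul_inv] at h2

theorem integrableOn_slicePairing {lam : ℝ} (hlam : 0 ≤ lam) (h : ℝ) (Λ : 𝓢(ℝ, ℂ) →L[ℂ] ℂ)
    (φ : 𝓢(ℝ × ℝ, ℂ)) : IntegrableOn (slicePairing lam h Λ φ) (Set.Ioi 0) := by
  obtain ⟨m, C, -, hb⟩ := exists_norm_slicePairing_le hlam h Λ
  refine Integrable.mono' (integrable_inv_one_add_sq.integrableOn.const_mul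
    (C * schwartzSup m (timeWeight (m.1 + 1) φ)))
    (continuous_slicePairing lam h Λ φ).aestronglyMeasurable ?_
  filter_upwards [ae_restrict_mem measurableSet_Ioi] with s hs
  exact hb φ s (le_of_lt hs)

theorem tendsto_slicePairing_atTop {lam : ℝ} (hlam : 0 ≤ lam) (h : ℝ) (Λ : 𝓢(ℝ, ℂ) →L[ℂ] ℂ)
    (φ : 𝓢(ℝ × ℝ, ℂ)) : Filter.Tendsto (slicePairing lam h Λ φ) Filter.atTop (nhds 0) := by
  obtain ⟨m, C, -, hb⟩ := exists_norm_slicePairing_le hlam h Λ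
  have h1 : Filter.Tendsto (fun s : ℝ => C * schwartzSup m (timeWeight (m.1 + 1) φ) *
      (1 + s ^ 2)⁻¹) Filter.atTop (nhds 0) := by
    have h2 : Filter.Tendsto (fun s : ℝ => (1 + s ^ 2)⁻¹) Filter.atTop (nhds 0) :=
      (Filter.tendsto_atTop_add_const_left _ 1 (Filter.tendsto_pow_atTop two_ne_zero)).inv_tendsto_atTop
    simpa using h2.const_mul (C * schwartzSup m (timeWeight (m.1 + 1) φ))
  refine squeeze_zero_norm' ?_ h1
  filter_upwards [Filter.eventually_ge_atTop 0] with s hs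
  exact hb φ s hs

/-- There is a tempered distribution that pairs with `φ` as the time integral of the evolution. -/
theorem exists_distribution_integral_slicePairing {lam : ℝ} (hlam : 0 ≤ lam) (h : ℝ)
    (Λ : 𝓢(ℝ, ℂ) →L[ℂ] ℂ) :
    ∃ f : 𝓢(ℝ × ℝ, ℂ) →L[ℂ] ℂ, ∀ φ, f φ = ∫ s in Set.Ioi 0, slicePairing lam h Λ φ s := by
  obtain ⟨m, C, hC, hb⟩ := exists_norm_slicePairing_le hlam h Λ
  set K : 𝓢(ℝ × ℝ, ℂ) →ₗ[ℂ] ℂ :=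
    { toFun := fun φ => ∫ s in Set.Ioi 0, slicePairing lam h Λ φ s
      map_add' := fun φ ψ => by
        rw [← integral_add (integrableOn_slicePairing hlam h Λ φ)
          (integrableOn_slicePairing hlam h Λ ψ)]
        exact integral_congr_ae (.of_forall fun s => poissonPairing_add _ _ _ _ _ _ s)
      map_smul' := fun c φ => by
        rw [RingHom.id_apply, ← integral_smul]
        exact integral_congr_ae (.of_forall fun s => poissonPairing_smul _ _ _ _ _ _ s) } with hK
  have hbound : ∀ φ, ‖K φ‖ ≤ (C * ∫ s : ℝ in Set.Ioi 0, (1 + s ^ 2)⁻¹) *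
      schwartzSup m (timeWeight (m.1 + 1) φ) := fun φ => by
    have h1 := norm_integral_le_of_norm_le (integrable_inv_one_add_sq.integrableOn.const_mul
      (C * schwartzSup m (timeWeight (m.1 + 1) φ)))
      (f := slicePairing lam h Λ φ) (μ := volume.restrict (Set.Ioi 0)) (by
        filter_upwards [ae_restrict_mem measurableSet_Ioi] with s hs
        exact hb φ s (le_of_lt hs))
    rw [integral_const_mul] at h1
    calc ‖K φ‖ ≤ _ := h1
      _ = _ := by ring
  -- The bounding seminorm is continuous, as the composition of a continuous seminorm with a
  -- continuous linear map.
  have hcont : Continuous ((schwartzSup m).comp (timeWeight (m.1 + 1)).toLinearMap) := by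
    have h1 : Continuous (schwartzSup (E := ℝ × ℝ) m) :=
      Seminorm.continuous_finsetSup
        fun i _ => (schwartz_withSeminorms ℂ (ℝ × ℝ) ℂ).continuous_seminorm i
    exact h1.comp (timeWeight (m.1 + 1)).continuous
  refine ⟨⟨K, ?_⟩, fun φ => rfl⟩
  refine continuous_of_continuousAt_zero K ?_
  rw [ContinuousAt, map_zero]
  have h2 := (hcont.tendsto 0).const_mul (C * ∫ s : ℝ in Set.Ioi 0, (1 + s ^ 2)⁻¹)
  rw [map_zero, mul_zero] at h2
  exact squeeze_zero_norm (fun φ => hbound φ) h2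

end Existence

/-! ### Existence of a solution -/

/-- A tempered distribution as a continuous linear functional; only the topology on the space of
all of them is forgotten. -/
def temperedFunctional {E : Type*} [NormedAddCommGroup E] [NormedSpace ℝ E] (f : 𝓢'(E, ℂ)) :
    𝓢(E, ℂ) →L[ℂ] ℂ := f

/-- After division by `3 / (ρη)`, the test function in the weak equation is the evolution generator
applied to `φ`. -/
theorem isTemperedSolution_iff {ρ η : ℝ} (hρ : 0 < ρ) (hη : 0 < η) (h : ℝ) (fIn : 𝓢'(ℝ, ℂ))
    (f : 𝓢'(ℝ × ℝ, ℂ)) :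
    IsTemperedSolution ρ η h fIn f ↔ Distribution.dsupport f ⊆ halfPlane ∧
      ∀ φ, f (evolutionGenerator (2 * ρ * η / 3) (0, h) (1, 0) φ) = -fIn (timeSlice 0 φ) := by
  refine and_congr_right fun _ => forall_congr' fun φ => ?_
  have e1 : secondDiff h φ = (2 : ℂ) • (schwartzAverage ((0, h) : ℝ × ℝ) φ - φ) := by
    ext ⟨t, x⟩
    simp [secondDiff_apply, schwartzAverage_apply]
    ring
  have hc : ((3 / (ρ * η) : ℝ) : ℂ) * ((2 * ρ * η / 3 : ℝ) : ℂ) = 2 := by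
    rw [← Complex.ofReal_mul]
    have : 3 / (ρ * η) * (2 * ρ * η / 3) = 2 := by field_simp
    rw [this, Complex.ofReal_ofNat]
  have hc0 : ((3 / (ρ * η) : ℝ) : ℂ) ≠ 0 := by
    rw [Complex.ofReal_ne_zero]
    positivity
  rw [e1, evolutionGenerator, map_smul, map_add, map_smul, smul_eq_mul, smul_eq_mul, ← hc,
    mul_assoc, ← mul_add, ← mul_add, mul_eq_zero, or_iff_right hc0, timeDeriv,
    eq_neg_iff_add_eq_zero, add_right_comm]

theorem exists_isTemperedSolution {ρ η : ℝ} (hρ : 0 < ρ) (hη : 0 < η) (h : ℝ)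
    (fIn : 𝓢'(ℝ, ℂ)) :
    ∃ f : 𝓢'(ℝ × ℝ, ℂ), IsTemperedSolution ρ η h fIn f ∧
      ∀ φ, f φ = ∫ s in Set.Ioi 0, slicePairing (2 * ρ * η / 3) h (temperedFunctional fIn) φ s := by
  have hlam : 0 ≤ 2 * ρ * η / 3 := by positivity
  obtain ⟨f, hf⟩ := exists_distribution_integral_slicePairing hlam h (temperedFunctional fIn)
  refine ⟨f, (isTemperedSolution_iff hρ hη h fIn f).2 ⟨?_, fun φ => ?_⟩, hf⟩
  · have hclosed : IsClosed halfPlane := isClosed_Ici.prod isClosed_univ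
    refine Set.sInter_subset_of_mem ⟨fun φ hφ => ?_, hclosed⟩
    refine (hf φ).trans ?_
    refine setIntegral_eq_zero_of_forall_eq_zero fun s hs => ?_
    have e : timeSlice s φ = 0 := by
      ext x
      rw [timeSlice_apply]
      refine image_eq_zero_of_notMem_tsupport fun hx => hφ hx ?_
      exact ⟨le_of_lt (Set.mem_Ioi.1 hs), Set.mem_univ _⟩
    rw [slicePairing_eq_tsum, e]
    simp
  · refine (hf _).trans ?_
    rw [integral_Ioi_of_hasDerivAt_of_tendsto' (fun s _ => hasDerivAt_slicePairing _ h _ φ s)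
      (integrableOn_slicePairing hlam h _ _) (tendsto_slicePairing_atTop hlam h _ φ), zero_sub]
    exact congrArg Neg.neg (poissonPairing_zero _ _ _ _ φ)

/-! ### Compactly supported test functions -/

section CompactSupport

variable {E : Type*} [NormedAddCommGroup E] [NormedSpace ℝ E] [FiniteDimensional ℝ E]

/-- A tempered distribution annihilates compactly supported test functions supported away from its
support; a partition of unity reduces this to the local definition of the support. -/
theorem apply_eq_zero_of_tsupport_subset_compl_dsupport (f : 𝓢'(E, ℂ)) {φ : 𝓢(E, ℂ)}
    (hc : HasCompactSupport φ) (hφ : tsupport φ ⊆ (Distribution.dsupport f)ᶜ) : f φ = 0 := by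
  have hloc : ∀ x : tsupport φ, ∃ U : Set E,
      Distribution.IsVanishingOn f U ∧ IsOpen U ∧ (x : E) ∈ U := fun x =>
    (Distribution.notMem_dsupport_iff (x : E)).1 (hφ x.2)
  choose U hU hUo hxU using hloc
  obtain ⟨T, hT⟩ := hc.isCompact.elim_finite_subcover U hUo
    fun x hx => Set.mem_iUnion.2 ⟨⟨x, hx⟩, hxU ⟨x, hx⟩⟩
  obtain ⟨p, hp⟩ := SmoothPartitionOfUnity.exists_isSubordinate (modelWithCornersSelf ℝ E)
    (isClosed_tsupport φ) (fun i : T => U i) (fun i => hUo i)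
    (fun x hx => by simpa using hT hx)
  have hsm : ∀ i, ContDiff ℝ ∞ fun x => (p i x : ℂ) * φ x := fun i =>
    (Complex.ofRealCLM.contDiff.comp (p i).contMDiff.contDiff).mul (φ.smooth ⊤)
  have hcs : ∀ i, HasCompactSupport fun x => (p i x : ℂ) * φ x := fun i => hc.mul_left
  have hzero : ∀ i, f ((hcs i).toSchwartzMap (hsm i)) = 0 := fun i => by
    refine hU i _ ((closure_mono ?_).trans (hp i))
    intro x hx
    rw [Function.mem_support] at hx ⊢
    intro h0
    refine hx ?_
    simp [h0]
  have hsum : φ = ∑ i, (hcs i).toSchwartzMap (hsm i) := by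
    ext x
    rw [sum_apply]
    simp only [HasCompactSupport.toSchwartzMap_toFun]
    by_cases hx : x ∈ tsupport φ
    · have h1 := p.sum_eq_one hx
      rw [finsum_eq_sum_of_fintype] at h1
      rw [← Finset.sum_mul, ← Complex.ofReal_sum, h1, Complex.ofReal_one, one_mul]
    · simp [image_eq_zero_of_notMem_tsupport hx]
  rw [hsum, map_sum]
  exact Finset.sum_eq_zero fun i _ => hzero i

/-- The derivatives of the dilated cutoffs are bounded uniformly in the dilation. -/
theorem exists_bound_iteratedFDeriv_bump (χ : ContDiffBump (0 : E)) (n : ℕ) :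
    ∃ C : ℝ, 0 ≤ C ∧ ∀ x : E, ∀ R : ℝ, 1 ≤ R → ∀ i ≤ n,
      ‖iteratedFDeriv ℝ i (fun y => 1 - (χ (R⁻¹ • y) : ℂ)) x‖ ≤ C := by
  have hsm : ContDiff ℝ ∞ fun y : E => 1 - (χ y : ℂ) :=
    contDiff_const.sub (Complex.ofRealCLM.contDiff.comp χ.contDiff)
  have hbd : ∀ i : ℕ, ∃ C : ℝ, ∀ x : E, ‖iteratedFDeriv ℝ i (fun y => 1 - (χ y : ℂ)) x‖ ≤ C := by
    intro i
    rcases i with _ | i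
    · refine ⟨1 + 1, fun x => ?_⟩
      rw [norm_iteratedFDeriv_zero]
      refine (norm_sub_le _ _).trans ?_
      rw [norm_one, Complex.norm_real, Real.norm_of_nonneg χ.nonneg]
      gcongr
      exact χ.le_one
    · have hcs : HasCompactSupport (iteratedFDeriv ℝ (i + 1) fun y => 1 - (χ y : ℂ)) := by
        have h1 : HasCompactSupport (fderiv ℝ fun y => 1 - (χ y : ℂ)) := by
          have e : (fderiv ℝ fun y : E => 1 - (χ y : ℂ)) = fun y =>
              -fderiv ℝ (fun y : E => (χ y : ℂ)) y := by
            ext1 y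
            rw [fderiv_const_sub]
          rw [e]
          have h2 : HasCompactSupport fun y : E => (χ y : ℂ) :=
            χ.hasCompactSupport.comp_left (g := fun r : ℝ => (r : ℂ)) Complex.ofReal_zero
          exact (h2.fderiv ℝ).neg
        have h3 : HasCompactSupport
            (iteratedFDeriv ℝ i (fderiv ℝ fun y => 1 - (χ y : ℂ))) := h1.iteratedFDeriv i
        refine h3.mono' ?_
        refine (Function.support_subset_iff'.2 fun x hx => ?_).trans subset_closure
        rw [Function.notMem_support] at hx
        rw [← norm_eq_zero, ← norm_iteratedFDeriv_fderiv, hx, norm_zero]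
      obtain ⟨C, hC⟩ := hcs.exists_bound_of_continuous
        (hsm.continuous_iteratedFDeriv (m := i + 1) (by exact_mod_cast le_top))
      exact ⟨C, hC⟩
  choose C hC using hbd
  refine ⟨∑ i ∈ Finset.range (n + 1), |C i|, by positivity, fun x R hR i hi => ?_⟩
  have e : (fun y : E => 1 - (χ (R⁻¹ • y) : ℂ)) =
      (fun y : E => 1 - (χ y : ℂ)) ∘ (R⁻¹ • ContinuousLinearMap.id ℝ E) := by
    ext y
    simp
  have hn : ‖R⁻¹ • ContinuousLinearMap.id ℝ E‖ ≤ 1 := by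
    rw [norm_smul, Real.norm_of_nonneg (by positivity)]
    exact mul_le_one₀ (inv_le_one_of_one_le₀ hR) (norm_nonneg _) ContinuousLinearMap.norm_id_le
  rw [e, ContinuousLinearMap.iteratedFDeriv_comp_right _ hsm _ (by exact_mod_cast le_top)]
  calc _ ≤ ‖iteratedFDeriv ℝ i (fun y : E => 1 - (χ y : ℂ)) ((R⁻¹ • ContinuousLinearMap.id ℝ E) x)‖ *
        ∏ _j : Fin i, ‖R⁻¹ • ContinuousLinearMap.id ℝ E‖ :=
        ContinuousMultilinearMap.norm_compContinuousLinearMap_le _ _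
    _ ≤ C i * 1 := by
      refine mul_le_mul (hC i _) (Finset.prod_le_one (fun _ _ => norm_nonneg _) fun _ _ => hn)
        (Finset.prod_nonneg fun _ _ => norm_nonneg _) ((norm_nonneg _).trans (hC i 0))
    _ ≤ |C i| := by rw [mul_one]; exact le_abs_self _
    _ ≤ _ := Finset.single_le_sum (f := fun i => |C i|) (fun _ _ => abs_nonneg _)
      (Finset.mem_range_succ_iff.2 hi)

/-- Compactly supported test functions suffice to identify a continuous functional on Schwartz
space. -/
theorem eq_zero_of_forall_hasCompactSupport (Λ : 𝓢(E, ℂ) →L[ℂ] ℂ)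
    (hΛ : ∀ φ : 𝓢(E, ℂ), HasCompactSupport φ → Λ φ = 0) : Λ = 0 := by
  ext φ
  obtain ⟨m, A, hA, hbound⟩ := exists_norm_le_schwartzSup Λ
  set χ : ContDiffBump (0 : E) := ⟨1, 2, one_pos, one_lt_two⟩ with hχ
  obtain ⟨C, hC, hbump⟩ := exists_bound_iteratedFDeriv_bump χ m.2
  set Q := schwartzSup (m.1 + 1, m.2) φ with hQ
  have hQ0 : 0 ≤ Q := apply_nonneg _ _
  set D := 2 ^ m.2 * C * (2 ^ (m.1 + 1) * Q) with hD
  have hD0 : 0 ≤ D := by positivity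
  have key : ∀ R : ℝ, 1 ≤ R → ‖Λ φ‖ ≤ A * D * R⁻¹ := fun R hR => by
    have hR0 : 0 < R := one_pos.trans_le hR
    have hsm : ContDiff ℝ ∞ fun x => (χ (R⁻¹ • x) : ℂ) * φ x :=
      (Complex.ofRealCLM.contDiff.comp
        (χ.contDiff.comp (contDiff_const_smul R⁻¹))).mul (φ.smooth ⊤)
    have hcs : HasCompactSupport fun x => (χ (R⁻¹ • x) : ℂ) * φ x := by
      refine HasCompactSupport.mul_right ?_
      have h1 : HasCompactSupport fun x => χ (R⁻¹ • x) :=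
        χ.hasCompactSupport.comp_smul (inv_ne_zero hR0.ne')
      exact h1.comp_left (g := fun r : ℝ => (r : ℂ)) Complex.ofReal_zero
    set ψ := hcs.toSchwartzMap hsm with hψ
    have hfun : ((φ - ψ : 𝓢(E, ℂ)) : E → ℂ) = fun x => (1 - (χ (R⁻¹ • x) : ℂ)) * φ x := by
      ext x
      rw [sub_apply, hψ, HasCompactSupport.toSchwartzMap_toFun]
      ring
    have hsm' : ContDiff ℝ ∞ fun x : E => 1 - (χ (R⁻¹ • x) : ℂ) :=
      contDiff_const.sub (Complex.ofRealCLM.contDiff.comp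
        (χ.contDiff.comp (contDiff_const_smul R⁻¹)))
    have hle : schwartzSup m (φ - ψ) ≤ D * R⁻¹ := by
      refine schwartzSup_le_bound (by positivity) fun k n hk hn x => ?_
      rw [hfun]
      by_cases hx : ‖x‖ < R
      · -- Near such a point the cutoff is identically one.
        have h1 : (fun x : E => (1 - (χ (R⁻¹ • x) : ℂ)) * φ x) =ᶠ[nhds x] fun _ => 0 := by
          filter_upwards [Metric.isOpen_ball.mem_nhds (mem_ball_zero_iff.2 hx)] with y hy
          rw [mem_ball_zero_iff] at hy
          have h2 : χ (R⁻¹ • y) = 1 := by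
            refine χ.one_of_mem_closedBall ?_
            rw [mem_closedBall_zero_iff, norm_smul, Real.norm_of_nonneg (by positivity),
              inv_mul_le_iff₀ hR0]
            simpa [hχ] using hy.le
          rw [h2, Complex.ofReal_one, sub_self, zero_mul]
        have h2 : iteratedFDeriv ℝ n (fun x : E => (1 - (χ (R⁻¹ • x) : ℂ)) * φ x) x = 0 := by
          rw [(h1.iteratedFDeriv ℝ n).eq_of_nhds]
          exact congrFun (iteratedFDeriv_fun_zero (𝕜 := ℝ) (n := n)) x
        rw [h2, norm_zero, mul_zero]
        positivity
      · rw [not_lt] at hx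
        have h1 := norm_iteratedFDeriv_mul_le hsm' (φ.smooth ⊤) x (n := n)
          (by exact_mod_cast le_top)
        have h2 : ‖x‖ ^ k ≤ R⁻¹ * (1 + ‖x‖) ^ (k + 1) := by
          rw [le_inv_mul_iff₀ hR0, pow_succ, mul_comm]
          gcongr <;> linarith
        have h3 : ∀ j ≤ n, R⁻¹ * (1 + ‖x‖) ^ (k + 1) * ‖iteratedFDeriv ℝ j φ x‖ ≤
            R⁻¹ * (2 ^ (m.1 + 1) * Q) := fun j hj => by
          rw [mul_assoc]
          refine mul_le_mul_of_nonneg_left ?_ (by positivity)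
          exact one_add_norm_pow_mul_le_schwartzSup (m := (m.1 + 1, m.2)) (Nat.add_le_add_right hk 1)
            (hj.trans hn) φ x
        calc _ ≤ ‖x‖ ^ k * ∑ i ∈ Finset.range (n + 1), (n.choose i : ℝ) *
              ‖iteratedFDeriv ℝ i (fun x : E => 1 - (χ (R⁻¹ • x) : ℂ)) x‖ *
              ‖iteratedFDeriv ℝ (n - i) φ x‖ := by gcongr
          _ ≤ ∑ i ∈ Finset.range (n + 1), (n.choose i : ℝ) * (C * (R⁻¹ * (2 ^ (m.1 + 1) * Q))) := by
            rw [Finset.mul_sum]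
            refine Finset.sum_le_sum fun i hi => ?_
            rw [Finset.mem_range_succ_iff] at hi
            have h4 := hbump x R hR i (hi.trans hn)
            calc _ = (n.choose i : ℝ) *
                  (‖iteratedFDeriv ℝ i (fun x : E => 1 - (χ (R⁻¹ • x) : ℂ)) x‖ *
                  (‖x‖ ^ k * ‖iteratedFDeriv ℝ (n - i) φ x‖)) := by ring
              _ ≤ (n.choose i : ℝ) * (C *
                  (R⁻¹ * (1 + ‖x‖) ^ (k + 1) * ‖iteratedFDeriv ℝ (n - i) φ x‖)) := by gcongr
              _ ≤ _ := by
                gcongr (n.choose i : ℝ) * (C * ?_)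
                exact h3 _ (Nat.sub_le n i)
          _ = 2 ^ n * (C * (R⁻¹ * (2 ^ (m.1 + 1) * Q))) := by
            rw [← Finset.sum_mul]
            congr 1
            exact_mod_cast Nat.sum_range_choose n
          _ ≤ 2 ^ m.2 * (C * (R⁻¹ * (2 ^ (m.1 + 1) * Q))) := by
            gcongr
            norm_num
          _ = _ := by
            rw [hD]
            ring
    have h1 := hbound (φ - ψ)
    rw [map_sub, hΛ ψ hcs, sub_zero] at h1
    calc ‖Λ φ‖ ≤ A * schwartzSup m (φ - ψ) := h1
      _ ≤ A * (D * R⁻¹) := by gcongr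
      _ = _ := by ring
  have hlim : Filter.Tendsto (fun R : ℝ => A * D * R⁻¹) Filter.atTop (nhds 0) := by
    simpa using tendsto_inv_atTop_zero.const_mul (A * D)
  have h0 : ‖Λ φ‖ ≤ 0 := ge_of_tendsto hlim
    ((Filter.eventually_ge_atTop 1).mono fun R hR => key R hR)
  simpa using h0

end CompactSupport

/-! ### Uniqueness for tempered data -/

section Uniqueness

/-- Averages of translates of a test function supported in a bounded region of negative times are
again of that kind. -/
theorem average_pow_support {h R : ℝ} (hh : 0 ≤ h) {k : ℕ} {φ : 𝓢(ℝ × ℝ, ℂ)}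
    (hφ : ∀ z, φ z ≠ 0 → z.1 ≤ -1 ∧ ‖z‖ ≤ R) :
    ∀ z, ((schwartzAverage ((0, h) : ℝ × ℝ) ^ k) φ) z ≠ 0 → z.1 ≤ -1 ∧ ‖z‖ ≤ R + k * h := by
  have hn : ‖((0, h) : ℝ × ℝ)‖ = h := by simp [Prod.norm_def, abs_of_nonneg hh, hh]
  induction k with
  | zero => simpa using hφ
  | succ k ih =>
    intro z hz
    rw [pow_succ', mul_apply_eq_comp, schwartzAverage_apply] at hz
    have h1 : ((schwartzAverage ((0, h) : ℝ × ℝ) ^ k) φ) (z + (0, h)) ≠ 0 ∨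
        ((schwartzAverage ((0, h) : ℝ × ℝ) ^ k) φ) (z - (0, h)) ≠ 0 := by
      by_contra! hcon
      rw [hcon.1, hcon.2] at hz
      simp at hz
    push_cast
    rcases h1 with h1 | h1
    · obtain ⟨h2, h3⟩ := ih _ h1
      have h4 := norm_sub_le (z + ((0, h) : ℝ × ℝ)) (0, h)
      rw [add_sub_cancel_right, hn] at h4
      exact ⟨by simpa using h2, by linarith⟩
    · obtain ⟨h2, h3⟩ := ih _ h1
      have h4 := norm_add_le (z - ((0, h) : ℝ × ℝ)) (0, h)
      rw [sub_add_cancel, hn] at h4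
      exact ⟨by simpa using h2, by linarith⟩

theorem apply_eq_zero_of_dsupport_subset_halfPlane {f : 𝓢'(ℝ × ℝ, ℂ)}
    (hf : Distribution.dsupport f ⊆ halfPlane) {R : ℝ} {φ : 𝓢(ℝ × ℝ, ℂ)}
    (hφ : ∀ z, φ z ≠ 0 → z.1 ≤ -1 ∧ ‖z‖ ≤ R) : f φ = 0 := by
  have hK : IsCompact (Metric.closedBall (0 : ℝ × ℝ) R) := isCompact_closedBall _ _
  have hc : HasCompactSupport φ := HasCompactSupport.intro hK fun z hz => by
    by_contra h0
    exact hz (mem_closedBall_zero_iff.2 (hφ z h0).2)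
  have hclosed : IsClosed {z : ℝ × ℝ | z.1 ≤ -1} := isClosed_le continuous_fst continuous_const
  refine apply_eq_zero_of_tsupport_subset_compl_dsupport f hc fun z hz hz' => ?_
  have h1 : z.1 ≤ -1 := closure_minimal (fun z hz => (hφ z hz).1) hclosed hz
  have h2 : 0 ≤ z.1 := (hf hz').1
  linarith

theorem isTemperedSolution_unique {ρ η h : ℝ} (hρ : 0 < ρ) (hη : 0 < η) (hh : 0 ≤ h)
    {fIn : 𝓢'(ℝ, ℂ)} {f₁ f₂ : 𝓢'(ℝ × ℝ, ℂ)} (h₁ : IsTemperedSolution ρ η h fIn f₁)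
    (h₂ : IsTemperedSolution ρ η h fIn f₂) : f₁ = f₂ := by
  rw [isTemperedSolution_iff hρ hη] at h₁ h₂
  set Λ := temperedFunctional f₁ - temperedFunctional f₂
  have hΛ : ∀ φ, Λ φ = f₁ φ - f₂ φ := fun φ => rfl
  have hinv : ∀ φ, Λ (evolutionGenerator (2 * ρ * η / 3) (0, h) (1, 0) φ) = 0 := fun φ => by
    rw [hΛ, h₁.2, h₂.2, sub_self]
  have hzero : Λ = 0 := by
    refine eq_zero_of_forall_hasCompactSupport Λ fun φ hφ => ?_
    obtain ⟨R, hR⟩ := hφ.isCompact.isBounded.exists_norm_le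
    -- After a translation by `R + 1` the test function lives in negative times.
    rw [← poissonPairing_eq_of_generator hinv φ (R + 1), poissonPairing]
    refine (tsum_congr fun k => ?_).trans tsum_zero
    have hsupp : ∀ z, schwartzTranslate ((R + 1) • ((1, 0) : ℝ × ℝ)) φ z ≠ 0 →
        z.1 ≤ -1 ∧ ‖z‖ ≤ R + ‖(R + 1) • ((1, 0) : ℝ × ℝ)‖ := fun z hz => by
      rw [schwartzTranslate_apply] at hz
      have h3 := hR _ (subset_closure (Function.mem_support.2 hz))
      constructor
      · have h4 := (le_abs_self _).trans ((norm_fst_le _).trans h3)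
        simp at h4
        linarith
      · have h4 := norm_sub_le (z + (R + 1) • ((1, 0) : ℝ × ℝ)) ((R + 1) • ((1, 0) : ℝ × ℝ))
        rw [add_sub_cancel_right] at h4
        linarith
    have hs := average_pow_support (k := k) hh hsupp
    rw [hΛ, apply_eq_zero_of_dsupport_subset_halfPlane h₁.1 hs,
      apply_eq_zero_of_dsupport_subset_halfPlane h₂.1 hs, sub_self, smul_zero]
  ext φ
  rw [← sub_eq_zero, ← hΛ, hzero]
  rfl

end Uniqueness

/-! ### The exponential of an operator minus the identity -/

section PoissonCurve

open scoped Nat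

variable {X : Type*} [NormedAddCommGroup X] [NormedSpace ℝ X]

/-- The curve `t ↦ exp (lam t (T - 1)) x` in a Banach space. -/
def poissonCurve (lam : ℝ) (T : X →L[ℝ] X) (x : X) (t : ℝ) : X :=
  Real.exp (-(lam * t)) • NormedSpace.exp ((lam * t) • T) x

theorem hasSum_poissonCurve [CompleteSpace X] (lam : ℝ) (T : X →L[ℝ] X) (x : X) (t : ℝ) :
    HasSum (fun k => poissonWeight (lam * t) k • (T ^ k) x) (poissonCurve lam T x t) := by
  have h1 := NormedSpace.exp_series_hasSum_exp' (𝕂 := ℝ) ((lam * t) • T)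
  have h2 := ((ContinuousLinearMap.apply ℝ X x).hasSum h1).const_smul (Real.exp (-(lam * t)))
  refine h2.congr_fun fun k => ?_
  simp only [ContinuousLinearMap.apply_apply, smul_pow, smul_apply, poissonWeight,
    smul_smul]
  congr 1
  ring

theorem poissonCurve_zero (lam : ℝ) (T : X →L[ℝ] X) (x : X) : poissonCurve lam T x 0 = x := by
  simp [poissonCurve]

theorem contDiff_poissonCurve [CompleteSpace X] (lam : ℝ) (T : X →L[ℝ] X) (x : X) :
    ContDiff ℝ ∞ (poissonCurve lam T x) := by
  have h1 : ContDiff ℝ ∞ (NormedSpace.exp : (X →L[ℝ] X) → (X →L[ℝ] X)) :=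
    contDiff_iff_contDiffAt.2 fun y => (NormedSpace.exp_analytic (𝕂 := ℝ) y).contDiffAt
  have h2 : ContDiff ℝ ∞ fun t : ℝ => (lam * t) • T :=
    (contDiff_const.mul contDiff_id).smul contDiff_const
  have h3 : ContDiff ℝ ∞ fun t : ℝ => Real.exp (-(lam * t)) :=
    Real.contDiff_exp.comp (contDiff_const.mul contDiff_id).neg
  exact h3.smul ((ContinuousLinearMap.apply ℝ X x).contDiff.comp (h1.comp h2))

theorem norm_pow_apply_le {T : X →L[ℝ] X} (hT : ∀ x, ‖T x‖ ≤ ‖x‖) (k : ℕ) (x : X) :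
    ‖(T ^ k) x‖ ≤ ‖x‖ := by
  induction k with
  | zero => simp
  | succ k ih =>
    rw [pow_succ', mul_apply_eq_comp]
    exact (hT _).trans ih

theorem norm_poissonCurve_le [CompleteSpace X] {lam t : ℝ} (ht : 0 ≤ lam * t) {T : X →L[ℝ] X}
    (hT : ∀ x, ‖T x‖ ≤ ‖x‖) (x : X) : ‖poissonCurve lam T x t‖ ≤ ‖x‖ := by
  have h1 := (hasSum_poissonWeight (lam * t)).mul_right ‖x‖
  rw [one_mul] at h1
  rw [← (hasSum_poissonCurve lam T x t).tsum_eq]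
  refine tsum_of_norm_bounded h1 fun k => ?_
  have h0 := poissonWeight_nonneg ht k
  rw [norm_smul, Real.norm_of_nonneg h0]
  gcongr
  exact norm_pow_apply_le hT k x

/-- An operator that intertwines two bounded operators intertwines their exponentials. -/
theorem map_poissonCurve [CompleteSpace X] {Y : Type*} [NormedAddCommGroup Y]
    [NormedSpace ℝ Y] [CompleteSpace Y] (lam : ℝ) {T : X →L[ℝ] X} {S : Y →L[ℝ] Y} (π : X →L[ℝ] Y) (h : ∀ x, π (T x) = S (π x))
    (x : X) (t : ℝ) : π (poissonCurve lam T x t) = poissonCurve lam S (π x) t := by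
  have hk : ∀ k, π ((T ^ k) x) = (S ^ k) (π x) := fun k => by
    induction k with
    | zero => simp
    | succ k ih => rw [pow_succ', pow_succ', mul_apply_eq_comp, mul_apply_eq_comp, h, ih]
  refine (π.hasSum (hasSum_poissonCurve lam T x t)).unique ?_
  refine (hasSum_poissonCurve lam S (π x) t).congr_fun fun k => ?_
  rw [map_smul, hk]

theorem poissonCurve_id [CompleteSpace X] (lam : ℝ) (x : X) (t : ℝ) :
    poissonCurve lam (ContinuousLinearMap.id ℝ X) x t = x := by
  have h := (hasSum_poissonWeight (lam * t)).smul_const x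
  rw [one_smul] at h
  refine (hasSum_poissonCurve lam _ x t).unique (h.congr_fun fun k => ?_)
  have e : (ContinuousLinearMap.id ℝ X) ^ k = 1 := one_pow k
  rw [e, one_apply_eq_self]

end PoissonCurve

/-! ### Averages of functions and the convolution kernel -/

section FunctionAverage

/-- The average `x ↦ (u (x + h) + u (x - h)) / 2` of two opposite translates of a function. -/
def functionAverage (h : ℝ) (u : ℝ → ℂ) (x : ℝ) : ℂ := (u (x + h) + u (x - h)) / 2

theorem functionAverage_iterate (h : ℝ) (k : ℕ) (u : ℝ → ℂ) (x : ℝ) :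
    (functionAverage h)^[k] u x =
      ∑ i ∈ Finset.range (k + 1), ((k.choose i : ℂ) / 2 ^ k) * u (x + ((k : ℝ) - 2 * i) * h) := by
  induction k generalizing u with
  | zero => simp
  | succ k ih =>
    have h1 := Finset.sum_choose_succ_mul
      (fun i _ => u (x + (((k + 1 : ℕ) : ℝ) - 2 * i) * h)) k
    rw [Function.iterate_succ_apply, ih]
    have h2 : ∑ i ∈ Finset.range (k + 1 + 1), (((k + 1).choose i : ℂ) / 2 ^ (k + 1)) *
        u (x + (((k + 1 : ℕ) : ℝ) - 2 * i) * h) =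
        (∑ i ∈ Finset.range (k + 2), ((k + 1).choose i : ℂ) *
          u (x + (((k + 1 : ℕ) : ℝ) - 2 * i) * h)) / 2 ^ (k + 1) := by
      rw [Finset.sum_div]
      exact Finset.sum_congr rfl fun i _ => by ring
    rw [h2, h1, ← Finset.sum_add_distrib, Finset.sum_div]
    refine Finset.sum_congr rfl fun i _ => ?_
    have e1 : x + (((k + 1 : ℕ) : ℝ) - 2 * i) * h = x + ((k : ℝ) - 2 * i) * h + h := by
      push_cast
      ring
    have e2 : x + (((k + 1 : ℕ) : ℝ) - 2 * ((i + 1 : ℕ) : ℝ)) * h =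
        x + ((k : ℝ) - 2 * i) * h - h := by
      push_cast
      ring
    rw [e1, e2, functionAverage, pow_succ]
    field_simp

theorem measurable_functionAverage_iterate (h : ℝ) (k : ℕ) {u : ℝ → ℂ} (hu : Measurable u) :
    Measurable ((functionAverage h)^[k] u) := by
  induction k with
  | zero => simpa using hu
  | succ k ih =>
    rw [Function.iterate_succ_apply']
    exact ((ih.comp (measurable_add_const h)).add (ih.comp (measurable_sub_const h))).div_const 2

theorem functionAverage_congr_ae (h : ℝ) {u v : ℝ → ℂ} (huv : u =ᵐ[volume] v) :
    functionAverage h u =ᵐ[volume] functionAverage h v := by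
  filter_upwards [(measurePreserving_add_right volume h).quasiMeasurePreserving.ae_eq_comp huv,
    (measurePreserving_sub_right volume h).quasiMeasurePreserving.ae_eq_comp huv] with x h1 h2
  simp only [Function.comp_apply] at h1 h2
  rw [functionAverage, functionAverage, h1, h2]

theorem functionAverage_iterate_nonneg (h : ℝ) (k : ℕ) {u : ℝ → ℂ} (hu : ∀ᵐ x : ℝ, 0 ≤ u x) :
    ∀ᵐ x : ℝ, 0 ≤ (functionAverage h)^[k] u x := by
  induction k with
  | zero => simpa using hu
  | succ k ih =>
    filter_upwards [(measurePreserving_add_right volume h).quasiMeasurePreserving.ae ih,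
      (measurePreserving_sub_right volume h).quasiMeasurePreserving.ae ih] with x h1 h2
    rw [Function.iterate_succ_apply', functionAverage]
    have h3 := add_nonneg h1 h2
    have h4 : (0 : ℂ) ≤ (1 / 2 : ℝ) := by exact_mod_cast (by norm_num : (0 : ℝ) ≤ 1 / 2)
    have h5 := mul_nonneg h3 h4
    convert h5 using 1
    push_cast
    ring

/-- The `k`-th summand of the kernel. -/
def gameKernelTerm (ρ η h t : ℝ) (k : ℕ) : Measure ℝ :=
  ∑ i ∈ Finset.range (k + 1),
    ENNReal.ofReal (Real.exp (-(2 * ρ * η * t / 3))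
        * ((η * ρ * t) ^ k / (3 ^ k * (k.factorial : ℝ))) * (k.choose i : ℝ))
      • Measure.dirac (-(((k : ℝ) - 2 * (i : ℝ)) * h))

theorem gameKernel_eq_sum (ρ η h t : ℝ) :
    gameKernel ρ η h t = Measure.sum (gameKernelTerm ρ η h t) := rfl

/-- The weights of the kernel are those of a Poisson number of fair coin tosses. -/
theorem gameKernel_weight_eq (ρ η t : ℝ) (k i : ℕ) :
    Real.exp (-(2 * ρ * η * t / 3)) * ((η * ρ * t) ^ k / (3 ^ k * (k.factorial : ℝ)))
      * (k.choose i : ℝ) = poissonWeight (2 * ρ * η / 3 * t) k * ((k.choose i : ℝ) / 2 ^ k) := by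
  have e1 : 2 * ρ * η / 3 * t = 2 * (η * ρ * t) / 3 := by ring
  have e2 : 2 * ρ * η * t / 3 = 2 * (η * ρ * t) / 3 := by ring
  rw [poissonWeight, e1, e2, div_pow]
  generalize η * ρ * t = a
  rw [mul_pow]
  field_simp

theorem integrable_gameKernelTerm (ρ η h t : ℝ) (k : ℕ) (u : ℝ → ℂ) :
    Integrable u (gameKernelTerm ρ η h t k) := by
  rw [gameKernelTerm, integrable_finsetSum_measure]
  exact fun i _ => (integrable_dirac (by simp)).smul_measure ENNReal.ofReal_ne_top

theorem integral_gameKernelTerm {ρ η t : ℝ} (ht : 0 ≤ 2 * ρ * η / 3 * t) (h : ℝ) (k : ℕ)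
    {V : Type*} [NormedAddCommGroup V] [NormedSpace ℝ V] [CompleteSpace V] (u : ℝ → V) :
    ∫ y, u y ∂(gameKernelTerm ρ η h t k) = poissonWeight (2 * ρ * η / 3 * t) k •
      ∑ i ∈ Finset.range (k + 1), ((k.choose i : ℝ) / 2 ^ k) • u (-(((k : ℝ) - 2 * i) * h)) := by
  have hw := poissonWeight_nonneg ht k
  rw [gameKernelTerm, integral_finsetSum_measure fun i _ =>
    (integrable_dirac (by simp)).smul_measure ENNReal.ofReal_ne_top, Finset.smul_sum]
  refine Finset.sum_congr rfl fun i _ => ?_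
  rw [integral_smul_measure, integral_dirac, gameKernel_weight_eq, smul_smul,
    ENNReal.toReal_ofReal (by positivity)]

theorem functionAverage_iterate_norm (h : ℝ) (k : ℕ) (u : ℝ → ℂ) (x : ℝ) :
    (functionAverage h)^[k] (fun y => (‖u y‖ : ℂ)) x =
      ((∑ i ∈ Finset.range (k + 1), ((k.choose i : ℝ) / 2 ^ k) *
        ‖u (x + ((k : ℝ) - 2 * i) * h)‖ : ℝ) : ℂ) := by
  rw [functionAverage_iterate]
  push_cast
  rfl

theorem integrable_gameKernel {ρ η t : ℝ} (ht : 0 ≤ 2 * ρ * η / 3 * t) (h : ℝ) (u : ℝ → ℂ) (x : ℝ)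
    (hs : Summable fun k => poissonWeight (2 * ρ * η / 3 * t) k •
      (functionAverage h)^[k] (fun y => (‖u y‖ : ℂ)) x) :
    Integrable (fun y => u (x - y)) (gameKernel ρ η h t) := by
  rw [gameKernel_eq_sum]
  refine integrable_sum_measure (fun k => integrable_gameKernelTerm ρ η h t k _) ?_
  refine hs.norm.congr fun k => ?_
  rw [integral_gameKernelTerm ht, norm_smul, functionAverage_iterate_norm, Complex.norm_real,
    Real.norm_of_nonneg (poissonWeight_nonneg ht k),
    Real.norm_of_nonneg (Finset.sum_nonneg fun i _ => by positivity), smul_eq_mul]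
  simp only [smul_eq_mul, sub_neg_eq_add]

theorem integral_gameKernel {ρ η t : ℝ} (ht : 0 ≤ 2 * ρ * η / 3 * t) (h : ℝ) {u : ℝ → ℂ} {x : ℝ}
    (hi : Integrable (fun y => u (x - y)) (gameKernel ρ η h t)) :
    ∫ y, u (x - y) ∂(gameKernel ρ η h t) =
      ∑' k, poissonWeight (2 * ρ * η / 3 * t) k • (functionAverage h)^[k] u x := by
  rw [gameKernel_eq_sum] at hi ⊢
  rw [← (hasSum_integral_measure hi).tsum_eq]
  refine tsum_congr fun k => ?_
  rw [integral_gameKernelTerm ht, functionAverage_iterate]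
  congr 1
  refine Finset.sum_congr rfl fun i _ => ?_
  rw [sub_neg_eq_add, Complex.real_smul]
  push_cast
  rfl

end FunctionAverage

/-! ### The evolution in `L^p` -/

section LpEvolution

variable (p : ENNReal) [Fact (1 ≤ p)]

/-- The translation `g ↦ g(· + a)` of `L^p`. -/
def lpTranslate (a : ℝ) :
    Lp ℂ p (volume : Measure ℝ) →L[ℝ] Lp ℂ p (volume : Measure ℝ) :=
  (Lp.compMeasurePreservingₗᵢ ℝ (fun x : ℝ => x + a)
    (measurePreserving_add_right volume a)).toContinuousLinearMap

theorem coeFn_lpTranslate (a : ℝ) (g : Lp ℂ p (volume : Measure ℝ)) :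
    (lpTranslate p a g : ℝ → ℂ) =ᵐ[volume] fun x => g (x + a) :=
  Lp.coeFn_compMeasurePreserving g (measurePreserving_add_right volume a)

theorem norm_lpTranslate (a : ℝ) (g : Lp ℂ p (volume : Measure ℝ)) :
    ‖lpTranslate p a g‖ = ‖g‖ :=
  Lp.norm_compMeasurePreserving g (measurePreserving_add_right volume a)

/-- The average of two opposite translations of `L^p`. -/
def lpAverage (h : ℝ) : Lp ℂ p (volume : Measure ℝ) →L[ℝ] Lp ℂ p (volume : Measure ℝ) :=
  (1 / 2 : ℝ) • (lpTranslate p h + lpTranslate p (-h))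

theorem lpAverage_apply (h : ℝ) (g : Lp ℂ p (volume : Measure ℝ)) :
    lpAverage p h g = (1 / 2 : ℝ) • (lpTranslate p h g + lpTranslate p (-h) g) := rfl

theorem norm_lpAverage_le (h : ℝ) (g : Lp ℂ p (volume : Measure ℝ)) :
    ‖lpAverage p h g‖ ≤ ‖g‖ := by
  have h1 := norm_add_le (lpTranslate p h g) (lpTranslate p (-h) g)
  rw [norm_lpTranslate, norm_lpTranslate] at h1
  rw [lpAverage_apply, norm_smul, Real.norm_of_nonneg (by norm_num)]
  linarith

theorem coeFn_lpAverage (h : ℝ) (g : Lp ℂ p (volume : Measure ℝ)) :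
    (lpAverage p h g : ℝ → ℂ) =ᵐ[volume] functionAverage h g := by
  rw [lpAverage_apply]
  filter_upwards [Lp.coeFn_smul (1 / 2 : ℝ) (lpTranslate p h g + lpTranslate p (-h) g),
    Lp.coeFn_add (lpTranslate p h g) (lpTranslate p (-h) g), coeFn_lpTranslate p h g,
    coeFn_lpTranslate p (-h) g] with x h1 h2 h3 h4
  rw [h1, Pi.smul_apply, h2, Pi.add_apply, h3, h4, functionAverage, ← sub_eq_add_neg,
    Complex.real_smul]
  push_cast
  ring

theorem coeFn_lpAverage_pow (h : ℝ) (k : ℕ) (g : Lp ℂ p (volume : Measure ℝ)) :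
    ((lpAverage p h ^ k) g : ℝ → ℂ) =ᵐ[volume] (functionAverage h)^[k] g := by
  induction k with
  | zero => simp
  | succ k ih =>
    rw [pow_succ', mul_apply_eq_comp, Function.iterate_succ_apply']
    exact (coeFn_lpAverage p h _).trans (functionAverage_congr_ae h ih)

/-- The series for the evolution in `L^p` also converges almost everywhere. -/
theorem hasSum_coeFn_poissonCurve (lam h : ℝ) (g : Lp ℂ p (volume : Measure ℝ)) (t : ℝ) :
    ∀ᵐ x : ℝ, HasSum (fun k => poissonWeight (lam * t) k • (functionAverage h)^[k] g x)
      (poissonCurve lam (lpAverage p h) g t x) := by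
  have hs : ∑' k, ‖poissonWeight (lam * t) k • (lpAverage p h ^ k) g‖ₑ ≠ ⊤ := by
    rw [tsum_enorm_ne_top_iff_summable_norm]
    refine Summable.of_nonneg_of_le (fun _ => norm_nonneg _) (fun k => ?_)
      ((hasSum_poissonWeight (lam * t)).summable.norm.mul_right ‖g‖)
    rw [norm_smul]
    gcongr
    exact norm_pow_apply_le (norm_lpAverage_le p h) k g
  have h1 := Lp.hasSum_coeFn_tsum hs
  rw [(hasSum_poissonCurve lam (lpAverage p h) g t).tsum_eq] at h1
  have h2 : ∀ᵐ x : ℝ, ∀ k, (poissonWeight (lam * t) k • (lpAverage p h ^ k) g :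
      Lp ℂ p (volume : Measure ℝ)) x = poissonWeight (lam * t) k • (functionAverage h)^[k] g x := by
    refine ae_all_iff.2 fun k => ?_
    filter_upwards [Lp.coeFn_smul (poissonWeight (lam * t) k) ((lpAverage p h ^ k) g),
      coeFn_lpAverage_pow p h k g] with x h3 h4
    rw [h3, Pi.smul_apply, h4]
  filter_upwards [h1, h2] with x h3 h4
  simpa only [h4] using h3

theorem functionAverage_iterate_congr_ae (h : ℝ) (k : ℕ) {u v : ℝ → ℂ} (huv : u =ᵐ[volume] v) :
    (functionAverage h)^[k] u =ᵐ[volume] (functionAverage h)^[k] v := by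
  induction k with
  | zero => simpa using huv
  | succ k ih =>
    rw [Function.iterate_succ_apply', Function.iterate_succ_apply']
    exact functionAverage_congr_ae h ih

/-- The absolute convergence of the series, from its convergence for the datum `|g|`. -/
theorem summable_poissonWeight_functionAverage_norm (lam h : ℝ)
    (g : Lp ℂ p (volume : Measure ℝ)) (t : ℝ) :
    ∀ᵐ x : ℝ, Summable fun k => poissonWeight (lam * t) k •
      (functionAverage h)^[k] (fun y => (‖g y‖ : ℂ)) x := by
  have hm : MemLp (fun y => (‖g y‖ : ℂ)) p volume := (Lp.memLp g).norm.ofReal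
  have h1 : ∀ᵐ x : ℝ, ∀ k, (functionAverage h)^[k] (hm.toLp _ : ℝ → ℂ) x =
      (functionAverage h)^[k] (fun y => (‖g y‖ : ℂ)) x :=
    ae_all_iff.2 fun k => functionAverage_iterate_congr_ae h k hm.coeFn_toLp
  filter_upwards [hasSum_coeFn_poissonCurve p lam h (hm.toLp _) t, h1] with x h2 h3
  simpa only [h3] using h2.summable

theorem isClosed_lpInterL2 : IsClosed (LpInterL2 p : Set
    (Lp ℂ p (volume : Measure ℝ) × Lp ℂ 2 (volume : Measure ℝ))) := by
  refine IsSeqClosed.isClosed fun w z hw hz => ?_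
  have h1 := tendstoInMeasure_of_tendsto_Lp ((continuous_fst.tendsto z).comp hz)
  have h2 := tendstoInMeasure_of_tendsto_Lp ((continuous_snd.tendsto z).comp hz)
  exact tendstoInMeasure_ae_unique (h1.congr_left fun n => hw n) h2

instance : CompleteSpace (LpInterL2 p) := (isClosed_lpInterL2 p).completeSpace_coe

/-- The average of two opposite translations of `L^p ∩ L²`. -/
def lpInterL2Average (h : ℝ) : LpInterL2 p →L[ℝ] LpInterL2 p :=
  (((lpAverage p h).prodMap (lpAverage 2 h)) ∘L (LpInterL2 p).subtypeL).codRestrict (LpInterL2 p)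
    fun w => ((coeFn_lpAverage p h w.1.1).trans (functionAverage_congr_ae h w.2)).trans
      (coeFn_lpAverage 2 h w.1.2).symm

/-- The evolution in `L²` lifts to a smooth curve in `L^p ∩ L²`. -/
theorem exists_lift_poissonCurve (lam h : ℝ) (g : Lp ℂ 2 (volume : Measure ℝ))
    (hg : MemLp g p volume) :
    ∃ w : ℝ → LpInterL2 p, ContDiff ℝ ∞ w ∧
      (∀ t, (w t).1.2 = poissonCurve lam (lpAverage 2 h) g t) ∧
      ∀ t, (w t).1.1 = poissonCurve lam (lpAverage p h) (hg.toLp g) t := by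
  refine ⟨poissonCurve lam (lpInterL2Average p h) ⟨(hg.toLp g, g), hg.coeFn_toLp⟩,
    contDiff_poissonCurve _ _ _, fun t => ?_, fun t => ?_⟩
  · exact map_poissonCurve lam
      (ContinuousLinearMap.snd ℝ _ _ ∘L (LpInterL2 p).subtypeL) (fun _ => rfl) _ t
  · exact map_poissonCurve lam
      (ContinuousLinearMap.fst ℝ _ _ ∘L (LpInterL2 p).subtypeL) (fun _ => rfl) _ t

theorem integral_lpTranslate (a : ℝ) (g : Lp ℂ 1 (volume : Measure ℝ)) :
    ∫ x, lpTranslate 1 a g x = ∫ x, g x :=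
  (integral_congr_ae (coeFn_lpTranslate 1 a g)).trans (integral_add_right_eq_self _ a)

theorem integral_poissonCurve (lam h : ℝ) (g : Lp ℂ 1 (volume : Measure ℝ)) (t : ℝ) :
    ∫ x, poissonCurve lam (lpAverage 1 h) g t x = ∫ x, g x := by
  have e : ∀ u : Lp ℂ 1 (volume : Measure ℝ), L1.integralCLM u = ∫ x, u x := fun u => by
    rw [← L1.integral_eq, L1.integral_eq_integral]
  have hinv : ∀ u : Lp ℂ 1 (volume : Measure ℝ), L1.integralCLM (lpAverage 1 h u) =
      ContinuousLinearMap.id ℝ ℂ (L1.integralCLM u) := fun u => by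
    rw [lpAverage_apply, map_smul, map_add, e, e, integral_lpTranslate, integral_lpTranslate,
      ContinuousLinearMap.id_apply, e, ← two_smul ℝ (∫ x, u x), smul_smul]
    norm_num
  have h1 := map_poissonCurve lam L1.integralCLM hinv g t
  rwa [poissonCurve_id, e, e] at h1

end LpEvolution

/-! ### The solution with square integrable data -/

section SquareIntegrable

/-- The solution `(t, x) ↦ ∑ₖ e^{-lam t} (lam t)^k / k! • (Aᵏ g)(x)` with datum `g`, where `A` is
the average of the translations by `± h`. -/
def evolutionFunction (lam h : ℝ) (g : Lp ℂ 2 (volume : Measure ℝ)) (z : ℝ × ℝ) : ℂ :=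
  ∑' k, poissonWeight (lam * z.1) k • (functionAverage h)^[k] g z.2

theorem stronglyMeasurable_evolutionFunction (lam h : ℝ) (g : Lp ℂ 2 (volume : Measure ℝ)) :
    StronglyMeasurable (evolutionFunction lam h g) := by
  refine StronglyMeasurable.tsum fun k => Measurable.stronglyMeasurable ?_
  have h1 : Measurable fun z : ℝ × ℝ => poissonWeight (lam * z.1) k := by
    unfold poissonWeight
    fun_prop
  exact h1.smul ((measurable_functionAverage_iterate h k
    (Lp.stronglyMeasurable g).measurable).comp measurable_snd)

theorem evolutionFunction_ae_eq (lam h : ℝ) (g : Lp ℂ 2 (volume : Measure ℝ)) (t : ℝ) :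
    (fun x => evolutionFunction lam h g (t, x)) =ᵐ[volume]
      (poissonCurve lam (lpAverage 2 h) g t : Lp ℂ 2 (volume : Measure ℝ)) := by
  filter_upwards [hasSum_coeFn_poissonCurve 2 lam h g t] with x hx
  exact hx.tsum_eq

theorem toTemperedDistribution_translate (a : ℝ) (g : Lp ℂ 2 (volume : Measure ℝ)) (ψ : 𝓢(ℝ, ℂ)) :
    Lp.toTemperedDistribution g (schwartzTranslate a ψ) =
      Lp.toTemperedDistribution (lpTranslate 2 (-a) g) ψ := by
  rw [Lp.toTemperedDistribution_apply, Lp.toTemperedDistribution_apply,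
    ← integral_sub_right_eq_self (fun x => schwartzTranslate a ψ x • g x) a]
  refine integral_congr_ae ?_
  filter_upwards [coeFn_lpTranslate 2 (-a) g] with x hx
  rw [hx, schwartzTranslate_apply, sub_add_cancel, sub_eq_add_neg]

/-- The pairing of a square integrable function with a test function, as a functional of the
former. -/
def pairingWith (ψ : 𝓢(ℝ, ℂ)) : Lp ℂ 2 (volume : Measure ℝ) →L[ℝ] ℂ :=
  ((PointwiseConvergenceCLM.evalCLM (RingHom.id ℂ) ℂ ψ) ∘L
    (Lp.toTemperedDistributionCLM ℂ (volume : Measure ℝ) 2)).restrictScalars ℝ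

theorem pairingWith_apply (ψ : 𝓢(ℝ, ℂ)) (g : Lp ℂ 2 (volume : Measure ℝ)) :
    pairingWith ψ g = Lp.toTemperedDistribution g ψ := rfl

theorem pairingWith_average_pow (h : ℝ) (k : ℕ) (ψ : 𝓢(ℝ, ℂ)) (g : Lp ℂ 2 (volume : Measure ℝ)) :
    pairingWith ((schwartzAverage h ^ k) ψ) g = pairingWith ψ ((lpAverage 2 h ^ k) g) := by
  induction k generalizing g with
  | zero => simp
  | succ k ih =>
    have h1 : ∀ χ : 𝓢(ℝ, ℂ), pairingWith (schwartzAverage h χ) g =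
        pairingWith χ (lpAverage 2 h g) := fun χ => by
      rw [lpAverage_apply, map_smul, map_add, pairingWith_apply, pairingWith_apply,
        pairingWith_apply, schwartzAverage_eq, map_smul, map_add, toTemperedDistribution_translate,
        toTemperedDistribution_translate, neg_neg, add_comm, Complex.real_smul, smul_eq_mul]
      norm_num
    rw [pow_succ', mul_apply_eq_comp, h1, ih, pow_succ, mul_apply_eq_comp]

/-- The evolution of test functions is dual to that of square integrable functions. -/
theorem slicePairing_toTemperedDistribution (lam h : ℝ) (g : Lp ℂ 2 (volume : Measure ℝ))
    (φ : 𝓢(ℝ × ℝ, ℂ)) (s : ℝ) :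
    slicePairing lam h (temperedFunctional (Lp.toTemperedDistribution g)) φ s =
      ∫ x, φ (s, x) * evolutionFunction lam h g (s, x) := by
  have h1 := (pairingWith (timeSlice s φ)).hasSum (hasSum_poissonCurve lam (lpAverage 2 h) g s)
  rw [slicePairing_eq_tsum]
  calc _ = ∑' k, pairingWith (timeSlice s φ) (poissonWeight (lam * s) k • (lpAverage 2 h ^ k) g) :=
        tsum_congr fun k => by
          rw [map_smul, ← pairingWith_average_pow]
          rfl
    _ = pairingWith (timeSlice s φ) (poissonCurve lam (lpAverage 2 h) g s) := h1.tsum_eq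
    _ = _ := by
      rw [pairingWith_apply, Lp.toTemperedDistribution_apply]
      refine integral_congr_ae ?_
      filter_upwards [evolutionFunction_ae_eq lam h g s] with x hx
      rw [← hx, smul_eq_mul, timeSlice_apply]

theorem norm_le_inv_one_add_sq_mul (φ : 𝓢(ℝ × ℝ, ℂ)) :
    ∃ C : ℝ, 0 ≤ C ∧ ∀ t x : ℝ, ‖φ (t, x)‖ ≤ C * (1 + t ^ 2)⁻¹ * (1 + x ^ 2)⁻¹ := by
  refine ⟨2 ^ 4 * schwartzSup (4, 0) φ, mul_nonneg (by positivity) (apply_nonneg _ _),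
    fun t x => ?_⟩
  have h1 := one_add_norm_pow_mul_le_schwartzSup (m := (4, 0)) (k := 4) (n := 0) le_rfl le_rfl φ
    (t, x)
  rw [norm_iteratedFDeriv_zero] at h1
  set N := ‖((t, x) : ℝ × ℝ)‖ with hN
  have hN0 : 0 ≤ N := norm_nonneg _
  have ht : t ^ 2 ≤ N ^ 2 := sq_le_sq' (neg_le_of_abs_le (norm_fst_le ((t, x) : ℝ × ℝ)))
    (le_of_abs_le (norm_fst_le ((t, x) : ℝ × ℝ)))
  have hx : x ^ 2 ≤ N ^ 2 := sq_le_sq' (neg_le_of_abs_le (norm_snd_le ((t, x) : ℝ × ℝ)))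
    (le_of_abs_le (norm_snd_le ((t, x) : ℝ × ℝ)))
  have h2 : (1 + t ^ 2) * (1 + x ^ 2) ≤ (1 + N) ^ 4 := by
    calc (1 + t ^ 2) * (1 + x ^ 2) ≤ (1 + N) ^ 2 * (1 + N) ^ 2 := by
          gcongr <;> nlinarith
      _ = _ := by ring
  rw [mul_assoc, ← mul_inv, ← div_eq_mul_inv, le_div_iff₀' (by positivity)]
  exact (mul_le_mul_of_nonneg_right h2 (norm_nonneg _)).trans h1

theorem memLp_two_inv_one_add_sq : MemLp (fun x : ℝ => (1 + x ^ 2)⁻¹) 2 volume := by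
  rw [memLp_two_iff_integrable_sq (by fun_prop)]
  refine integrable_inv_one_add_sq.mono (by fun_prop) (.of_forall fun x => ?_)
  have h0 : 0 ≤ (1 + x ^ 2)⁻¹ := by positivity
  have h1 : (1 + x ^ 2)⁻¹ ≤ 1 := inv_le_one_of_one_le₀ (by nlinarith)
  rw [norm_pow, Real.norm_of_nonneg h0]
  nlinarith

theorem volume_restrict_halfPlane :
    (volume : Measure (ℝ × ℝ)).restrict halfPlane =
      (volume.restrict (Set.Ici 0)).prod volume := by
  rw [halfPlane, Measure.volume_eq_prod, ← Measure.prod_restrict, Measure.restrict_univ]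

/-- The `L²` bound on the evolution, uniform in time, makes its product with a test function
integrable on the half plane. -/
theorem integrableOn_mul_evolutionFunction {lam : ℝ} (hlam : 0 ≤ lam) (h : ℝ)
    (g : Lp ℂ 2 (volume : Measure ℝ)) (φ : 𝓢(ℝ × ℝ, ℂ)) :
    IntegrableOn (fun z => φ z * evolutionFunction lam h g z) halfPlane := by
  have hmeas : AEStronglyMeasurable (fun z => φ z * evolutionFunction lam h g z)
      ((volume.restrict (Set.Ici 0)).prod (volume : Measure ℝ)) :=
    φ.continuous.aestronglyMeasurable.mul
      (stronglyMeasurable_evolutionFunction lam h g).aestronglyMeasurable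
  rw [IntegrableOn, volume_restrict_halfPlane]
  refine ⟨hmeas, ?_⟩
  obtain ⟨C, hC, hφ⟩ := norm_le_inv_one_add_sq_mul φ
  set W := eLpNorm (fun x : ℝ => (1 + x ^ 2)⁻¹) 2 volume with hW
  have hWtop : W < ⊤ := memLp_two_inv_one_add_sq.2
  have hslice : ∀ t ∈ Set.Ici (0 : ℝ), ∫⁻ x, ‖φ (t, x) * evolutionFunction lam h g (t, x)‖ₑ ≤
      ENNReal.ofReal (C * (1 + t ^ 2)⁻¹) * (W * eLpNorm g 2 volume) := by
    intro t ht
    have hlt : 0 ≤ lam * t := mul_nonneg hlam ht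
    have h1 : eLpNorm (poissonCurve lam (lpAverage 2 h) g t : Lp ℂ 2 (volume : Measure ℝ)) 2 volume ≤
        eLpNorm g 2 volume := by
      have h2 := norm_poissonCurve_le hlt (norm_lpAverage_le 2 h) g
      rw [Lp.norm_def, Lp.norm_def] at h2
      exact (ENNReal.toReal_le_toReal (Lp.eLpNorm_ne_top _) (Lp.eLpNorm_ne_top _)).1 h2
    have h3 : ∫⁻ x : ℝ, ‖(1 + x ^ 2)⁻¹ • poissonCurve lam (lpAverage 2 h) g t x‖ₑ ≤
        W * eLpNorm g 2 volume := by
      rw [← eLpNorm_one_eq_lintegral_enorm]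
      refine (eLpNorm_smul_le_mul_eLpNorm (p := 2) (q := 2) (r := 1) (Lp.aestronglyMeasurable _)
        memLp_two_inv_one_add_sq.1).trans ?_
      gcongr
    calc ∫⁻ x, ‖φ (t, x) * evolutionFunction lam h g (t, x)‖ₑ
        ≤ ∫⁻ x : ℝ, ENNReal.ofReal (C * (1 + t ^ 2)⁻¹) *
            ‖(1 + x ^ 2)⁻¹ • poissonCurve lam (lpAverage 2 h) g t x‖ₑ := by
          refine lintegral_mono_ae ?_
          filter_upwards [evolutionFunction_ae_eq lam h g t] with x hx
          rw [hx, enorm_mul, enorm_smul, ← mul_assoc]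
          gcongr
          rw [← ofReal_norm, ← ofReal_norm, ← ENNReal.ofReal_mul (by positivity),
            Real.norm_of_nonneg (by positivity : 0 ≤ (1 + x ^ 2)⁻¹)]
          exact ENNReal.ofReal_le_ofReal (hφ t x)
      _ = ENNReal.ofReal (C * (1 + t ^ 2)⁻¹) *
            ∫⁻ x : ℝ, ‖(1 + x ^ 2)⁻¹ • poissonCurve lam (lpAverage 2 h) g t x‖ₑ :=
        lintegral_const_mul' _ _ ENNReal.ofReal_ne_top
      _ ≤ _ := by gcongr
  rw [HasFiniteIntegral, lintegral_prod _ hmeas.enorm]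
  calc _ ≤ ∫⁻ t in Set.Ici (0 : ℝ), ENNReal.ofReal (C * (1 + t ^ 2)⁻¹) *
        (W * eLpNorm g 2 volume) := setLIntegral_mono' measurableSet_Ici hslice
    _ ≤ ∫⁻ t : ℝ, ENNReal.ofReal (C * (1 + t ^ 2)⁻¹) * (W * eLpNorm g 2 volume) :=
      setLIntegral_le_lintegral _ _
    _ = (∫⁻ t : ℝ, ENNReal.ofReal (C * (1 + t ^ 2)⁻¹)) * (W * eLpNorm g 2 volume) :=
      lintegral_mul_const' _ _ (ENNReal.mul_ne_top hWtop.ne (Lp.eLpNorm_ne_top g))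
    _ < ⊤ := by
      refine ENNReal.mul_lt_top ?_ (ENNReal.mul_lt_top hWtop (Lp.eLpNorm_lt_top g))
      exact (integrable_inv_one_add_sq.const_mul C).lintegral_lt_top

/-- The tempered solution with square integrable datum is the evolution function. -/
theorem isGivenBy_evolutionFunction {ρ η h : ℝ} (hρ : 0 < ρ) (hη : 0 < η) (hh : 0 ≤ h)
    (g : Lp ℂ 2 (volume : Measure ℝ)) {f : 𝓢'(ℝ × ℝ, ℂ)}
    (hf : IsTemperedSolution ρ η h (Lp.toTemperedDistribution g) f) :
    IsGivenBy f (evolutionFunction (2 * ρ * η / 3) h g) := by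
  have hlam : 0 ≤ 2 * ρ * η / 3 := by positivity
  obtain ⟨f', hf', hint⟩ := exists_isTemperedSolution hρ hη h (Lp.toTemperedDistribution g)
  rw [isTemperedSolution_unique hρ hη hh hf hf']
  refine ⟨(stronglyMeasurable_evolutionFunction _ h g).aestronglyMeasurable, fun φ => ?_⟩
  have hi := integrableOn_mul_evolutionFunction hlam h g φ
  refine ⟨hi, ?_⟩
  rw [IntegrableOn, volume_restrict_halfPlane] at hi
  rw [hint, volume_restrict_halfPlane, integral_prod _ hi, integral_Ici_eq_integral_Ioi]
  simp only [slicePairing_toTemperedDistribution]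

theorem evolutionFunction_nonneg {lam : ℝ} (hlam : 0 ≤ lam) (h : ℝ)
    (g : Lp ℂ 2 (volume : Measure ℝ)) (hg : ∀ᵐ x : ℝ, 0 ≤ g x) :
    ∀ᵐ z ∂(volume.restrict halfPlane), 0 ≤ evolutionFunction lam h g z := by
  rw [volume_restrict_halfPlane]
  have hmeas : MeasurableSet {z | 0 ≤ evolutionFunction lam h g z} :=
    (stronglyMeasurable_evolutionFunction lam h g).measurable measurableSet_Ici
  rw [Measure.ae_prod_iff_ae_ae hmeas]
  filter_upwards [ae_restrict_mem measurableSet_Ici] with t ht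
  have hlt : 0 ≤ lam * t := mul_nonneg hlam ht
  have h1 : ∀ᵐ x : ℝ, ∀ k, 0 ≤ (functionAverage h)^[k] g x :=
    ae_all_iff.2 fun k => functionAverage_iterate_nonneg h k hg
  filter_upwards [h1] with x hx
  refine tsum_nonneg fun k => ?_
  rw [Complex.real_smul]
  exact mul_nonneg (by exact_mod_cast poissonWeight_nonneg hlt k) (hx k)

end SquareIntegrable
end

theorem mainTheorem4 (ρ η h : ℝ) (hρ : 0 < ρ) (hη : 0 < η) (hh : 0 ≤ h) :
    -- existence and uniqueness for every tempered initial datum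
    (∀ fIn : 𝓢'(ℝ, ℂ), ∃! f : 𝓢'(ℝ × ℝ, ℂ), IsTemperedSolution ρ η h fIn f) ∧
    -- initial data in `L²`
    (∀ (g : Lp ℂ 2 (volume : Measure ℝ)) (f : 𝓢'(ℝ × ℝ, ℂ)),
      IsTemperedSolution ρ η h (Lp.toTemperedDistribution g) f →
      ∃ (F : ℝ × ℝ → ℂ) (u : ℝ → Lp ℂ 2 (volume : Measure ℝ)),
        -- the solution is a function, and it is a smooth curve in `L²` starting at `g`
        IsGivenBy f F ∧
        (∀ t : ℝ, 0 ≤ t → (fun x => F (t, x)) =ᵐ[volume] (u t : ℝ → ℂ)) ∧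
        u 0 = g ∧
        (∀ T : ℝ, 0 < T → ContDiffOn ℝ ∞ u (Set.Icc 0 T)) ∧
        -- it is the convolution of `g` with the kernel
        (∀ t : ℝ, 0 ≤ t → ∀ᵐ x : ℝ,
          Integrable (fun y => g (x - y)) (gameKernel ρ η h t) ∧
          F (t, x) = ∫ y, g (x - y) ∂(gameKernel ρ η h t)) ∧
        -- it is non-negative if `g` is
        ((∀ᵐ x : ℝ, 0 ≤ g x) → ∀ᵐ z ∂(volume.restrict halfPlane), 0 ≤ F z) ∧
        -- it is a smooth curve in `L^p ∩ L²` if `g` lies in `L^p`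
        (∀ (p : ENNReal) [Fact (1 ≤ p)], MemLp g p volume →
          ∃ w : ℝ → LpInterL2 p,
            (∀ t : ℝ, 0 ≤ t → (w t).1.2 = u t) ∧
            (∀ T : ℝ, 0 < T → ContDiffOn ℝ ∞ w (Set.Icc 0 T))) ∧
        -- conservation of mass if `g` lies in `L¹`
        (Integrable g volume →
          ∀ t : ℝ, 0 ≤ t →
            Integrable (u t) volume ∧ ∫ x, u t x = ∫ x, g x)) := by
  refine ⟨fun fIn => ?_, fun g f hf => ?_⟩
  · obtain ⟨f, hf, -⟩ := exists_isTemperedSolution hρ hη h fIn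
    exact ⟨f, hf, fun f' hf' => isTemperedSolution_unique hρ hη hh hf' hf⟩
  have hlam : 0 ≤ 2 * ρ * η / 3 := by positivity
  refine ⟨evolutionFunction (2 * ρ * η / 3) h g, poissonCurve (2 * ρ * η / 3) (lpAverage 2 h) g,
    isGivenBy_evolutionFunction hρ hη hh g hf, fun t _ => evolutionFunction_ae_eq _ h g t,
    poissonCurve_zero _ _ g, fun T _ => (contDiff_poissonCurve _ _ g).contDiffOn, fun t ht => ?_,
    evolutionFunction_nonneg hlam h g, fun p _ hp => ?_, fun hg t _ => ?_⟩
  · have hlt := mul_nonneg hlam ht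
    filter_upwards [summable_poissonWeight_functionAverage_norm 2 (2 * ρ * η / 3) h g t] with x hx
    have hi := integrable_gameKernel hlt h g x hx
    exact ⟨hi, (integral_gameKernel hlt h hi).symm⟩
  · obtain ⟨w, hw, hw2, -⟩ := exists_lift_poissonCurve p (2 * ρ * η / 3) h g hp
    exact ⟨w, fun t _ => hw2 t, fun T _ => hw.contDiffOn⟩
  · have hm : MemLp g 1 volume := memLp_one_iff_integrable.2 hg
    obtain ⟨w, -, hw2, hw1⟩ := exists_lift_poissonCurve 1 (2 * ρ * η / 3) h g hm
    have hae := (w t).2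
    change ((w t).1.1 : ℝ → ℂ) =ᵐ[volume] ((w t).1.2 : ℝ → ℂ) at hae
    rw [hw1, hw2] at hae
    refine ⟨(L1.integrable_coeFn _).congr hae, ?_⟩
    rw [← integral_congr_ae hae, integral_poissonCurve, integral_congr_ae hm.coeFn_toLp]
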